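/- Notation. For $\varphi:\mathbb{R}^d\to(-\infty,\infty]$ let $\varphi^*(x)=\sup_y\{x\cdot y-\varphi(y)\}$ be its Legendre transform. A function with values in $(-\infty,\infty]$ is proper if it is not identically $+\infty$, and $\operatorname{dom}\psi=\{x:\psi(x)\neq+\infty\}$. Let $X\subseteq\mathbb{R}^d$ be open (for instance $X=\mathbb{R}^d$). A proper lower semicontinuous convex function $\psi:\mathbb{R}^d\to(-\infty,\infty]$ is called a Laplacian expansion (with dual domain $X$) if $\psi=\varphi^*$ for some proper function $\varphi$, equal to $+\infty$ outside $X$, which is bounded from below, is finite almost everywhere and locally integrable on $X$, satisfies $\Delta\varphi\leqslant d$ on $X$ in the sense of distributions, i.e. $\int\varphi\,\Delta\eta\,dy\leqslant d\int\eta\,dy$ for all $0\leqslant\eta\in C_c^\infty(X)$, and is normalized pointwise by $\limsup_{r\downarrow0}\frac{1}{|B_r(y)|}\int_{B_r(y)}\varphi\,dz\leqslant\varphi(y)$ for every $y\in X$ (automatic if $\varphi$ is continuous on $X$). **Lemma.** Let $\psi$ be a Laplacian expansion with dual domain $X$. "Almost everywhere" refers to Lebesgue measure. (1) At almost every $x\in\operatorname{dom}\psi$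 the function $\psi$ is differentiable and has a Hessian $D^2\psi(x)$ in the sense of Alexandrov, i.e. a symmetric $A$ with $\psi(x+h)=\psi(x)+\nabla\psi(x)\cdot h+\frac12 Ah\cdot h+o(|h|^2)$; and $$\det D^2\psi(x)\geqslant1\quad\text{for a.e. }x\in\operatorname{dom}\psi\text{ with }\nabla\psi(x)\in X .$$ (2) $\nabla\psi$ increases volume: $|E|\leqslant|\nabla\psi(E)|$ for every Borel set $E$ of points of $\operatorname{dom}\psi$ at which $\psi$ is differentiable with $\nabla\psi(x)\in X$. (3) Let $\nu$ be a $\sigma$-finite Borel measure on $\mathbb{R}^d$, absolutely continuous with respect to Lebesgue measure, such that $x\in\operatorname{dom}\psi$ and $\nabla\psi(x)\in X$ for $\nu$-a.e. $x$. Then $\bar\nu=(\nabla\psi)_\#\nu$ is absolutely continuous, and (writing $\nu,\bar\nu$ also for the densities) $$\bar\nu(\nabla\psi(x))\leqslant\nu(x)\quad\text{for a.e. }x\in\operatorname{dom}\psi\text{ with }\nabla\psi(x)\in X .$$ If $X=\mathbb{R}^d$ the condition $\nabla\psi(x)\in X$ is void. -/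

import Mathlib

open MeasureTheory Filter Topology InnerProductSpace
open scoped ContDiff

/-- Euclidean space of dimension `d`. -/
abbrev Euc (d : ℕ) : Type := EuclideanSpace ℝ (Fin d)

noncomputable section

/-- The Legendre-Fenchel transform `φ^*(x) = sup_y (x · y - φ(y))` of an extended-real-valued
function. -/
def legendre {d : ℕ} (φ : Euc d → EReal) (x : Euc d) : EReal :=
  ⨆ y : Euc d, ((inner ℝ x y : ℝ) : EReal) - φ y

/-- A proper function: it never takes the value `-∞` and it is finite somewhere. -/
def IsProper {d : ℕ} (f : Euc d → EReal) : Prop :=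
  (∀ x, f x ≠ ⊥) ∧ ∃ x, f x ≠ ⊤

/-- Convexity of an extended-real-valued function: its epigraph is convex. -/
def IsConvexFn {d : ℕ} (f : Euc d → EReal) : Prop :=
  Convex ℝ {p : Euc d × ℝ | f p.1 ≤ (p.2 : EReal)}

/-- `Δ φ ≤ c` on the open set `X` in the sense of distributions: `φ` is finite almost everywhere
and locally integrable on `X`, and `∫ φ Δη ≤ c ∫ η` for every nonnegative test function
`η ∈ C_c^∞(X)`. -/
def DistribLaplacianLE {d : ℕ} (X : Set (Euc d)) (φ : Euc d → EReal) (c : ℝ) : Prop :=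
  (∀ᵐ y, y ∈ X → φ y ≠ ⊤ ∧ φ y ≠ ⊥) ∧
  LocallyIntegrableOn (fun y => (φ y).toReal) X ∧
  ∀ η : Euc d → ℝ, ContDiff ℝ ∞ η → HasCompactSupport η → tsupport η ⊆ X → (∀ y, 0 ≤ η y) →
    ∫ y, (φ y).toReal * Laplacian.laplacian η y ≤ c * ∫ y, η y

/-- The pointwise normalization that goes with a distributional upper bound on the Laplacian: at
each point of `X` the value of `φ` is at least the limit of its means over small balls, so that
`φ` has not been lowered on a null set. Every function that is continuous on `X` has this
property. -/
def AboveMeans {d : ℕ} (X : Set (Euc d)) (φ : Euc d → EReal) : Prop :=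
  ∀ y ∈ X, limsup (fun r : ℝ => ((⨍ z in Metric.ball y r, (φ z).toReal : ℝ) : EReal)) (𝓝[>] 0)
    ≤ φ y

/-- `ψ` is a Laplacian expansion (with dual domain the open set `X`): it is a proper lower
semicontinuous convex function which is the Legendre transform of a proper function `φ` on `X`
(extended by `+∞` outside `X`) that is bounded from below and satisfies `Δ φ ≤ d` on `X` in the
sense of distributions. -/
def IsLaplacianExpansion {d : ℕ} (X : Set (Euc d)) (ψ : Euc d → EReal) : Prop :=
  IsProper ψ ∧ LowerSemicontinuous ψ ∧ IsConvexFn ψ ∧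
  ∃ φ : Euc d → EReal, IsProper φ ∧ (∀ y, y ∉ X → φ y = ⊤) ∧ (∃ m : ℝ, ∀ y, (m : EReal) ≤ φ y) ∧
    DistribLaplacianLE X φ d ∧ AboveMeans X φ ∧ ψ = legendre φ

/-- The finite part of an extended-real-valued function. -/
def finPart {d : ℕ} (ψ : Euc d → EReal) (x : Euc d) : ℝ := (ψ x).toReal

/-- The map `∇ψ`. -/
def gradMap {d : ℕ} (ψ : Euc d → EReal) : Euc d → Euc d := gradient (finPart ψ)

/-- So push-forwards by `∇ψ` are never junk values. -/
theorem measurable_gradMap {d : ℕ} (ψ : Euc d → EReal) : Measurable (gradMap ψ) :=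
  (InnerProductSpace.toDual ℝ (Euc d)).symm.continuous.measurable.comp
    (measurable_fderiv ℝ (finPart ψ))

/-- `A` is the Hessian `D²ψ(x)` in the sense of Alexandrov: `A` is symmetric, `ψ` is
differentiable at `x`, and
`ψ(x + h) = ψ(x) + ∇ψ(x) · h + (1/2) (A h) · h + o(|h|²)` as `h → 0`. -/
def HasHessianAt {d : ℕ} (ψ : Euc d → EReal) (A : Euc d →L[ℝ] Euc d) (x : Euc d) : Prop :=
  (A : Euc d →ₗ[ℝ] Euc d).IsSymmetric ∧ DifferentiableAt ℝ (finPart ψ) x ∧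
  (fun h : Euc d => finPart ψ (x + h) - finPart ψ x - inner ℝ (gradMap ψ x) h
      - (1 / 2) * inner ℝ (A h) h) =o[𝓝 0] (fun h : Euc d => ‖h‖ ^ 2)

end

/-! Write `ψ = φ*`. Alexandrov's theorem for `ψ` comes from the resolvent `J = (1 + ∂ψ)⁻¹`, which is
1-Lipschitz and is the gradient of an explicit potential. Rademacher's theorem and a Sard argument
show that almost every `x` in the interior of the domain is `J (x + ∇ψ(x))` with `J` differentiable
and invertible to first order there. Inverting gives the Hessian `(DJ)⁻¹ - 1`, which is also the
derivative of `∇ψ` along points of differentiability (`IsResolvent.ae_exists_hessian`).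

For the determinant, let `A = D²ψ(x)`, `y = ∇ψ(x) ∈ X` and `C = (A + ε)⁻¹`. The upper quadratic
bound on `ψ` near `x` dualizes to `φ(z) ≥ x · z - ψ(x) + ½ C(z - y) · (z - y)` near `y`. If the
supremum defining `ψ(x)` were attained at `y`, this would touch `φ` from below there, and `Δφ ≤ d`
would give `tr C ≤ d`. Attainment is not assumed, so radial means of `φ` are compared at
near-maximizers close to `y` (`trace_inverse_hessian_le`). The arithmetic-geometric inequality then
gives `det C ≤ 1`, and `ε → 0` gives `det A ≥ 1`.

Nondegeneracy of `A` makes `∇ψ` injective on a set of almost all relevant points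
(`ConvexOn.eq_of_gradient_eq`). The area formula with Jacobian at least 1
(`IsRegularPoint.setLIntegral_comp_le`) yields the volume and density statements. -/

/-! ### Gradients of convex functions. -/

section ConvexBasics

variable {E : Type*} [NormedAddCommGroup E] [InnerProductSpace ℝ E]

theorem ConvexOn.add_fderiv_le {D : Set E} {f : E → ℝ} (hf : ConvexOn ℝ D f) {x z : E}
    (hx : x ∈ D) (hz : z ∈ D) {f' : E →L[ℝ] ℝ} (h : HasFDerivAt f f' x) :
    f x + f' (z - x) ≤ f z := by
  have h1 : ConvexOn ℝ (AffineMap.lineMap x z ⁻¹' D) (f ∘ AffineMap.lineMap (k := ℝ) x z) :=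
    hf.comp_affineMap _
  have h2 : HasDerivAt (f ∘ AffineMap.lineMap (k := ℝ) x z) (f' (z - x)) 0 := by
    have : HasFDerivAt f f' (AffineMap.lineMap (k := ℝ) x z 0) := by simpa using h
    exact this.comp_hasDerivAt 0 AffineMap.hasDerivAt_lineMap
  have h3 := h1.le_slope_of_hasDerivAt (x := 0) (y := 1) (by simpa using hx) (by simpa using hz)
    one_pos h2
  simp [slope_def_field] at h3
  rw [map_sub]
  linarith

theorem ConvexOn.add_inner_gradient_le [CompleteSpace E] {D : Set E} {f : E → ℝ}
    (hf : ConvexOn ℝ D f) {x z : E} (hx : x ∈ D) (hz : z ∈ D) (h : DifferentiableAt ℝ f x) :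
    f x + inner ℝ (gradient f x) (z - x) ≤ f z := by
  have := hf.add_fderiv_le hx hz h.hasGradientAt.hasFDerivAt
  simpa using this

/-- Approximate subgradients of a convex function near a point of differentiability are close
to the gradient at that point. -/
theorem approx_subgradient_near_gradient [CompleteSpace E] {D : Set E} {f : E → ℝ}
    (hf : ConvexOn ℝ D f) {x : E} (hx : D ∈ 𝓝 x) (h : DifferentiableAt ℝ f x) {ε : ℝ}
    (hε : 0 < ε) :
    ∃ δ > 0, ∀ z ∈ D, ‖z - x‖ ≤ δ → ∀ p : E, ∀ e ≤ δ,
      (∀ w ∈ D, f z + inner ℝ p (w - z) - e ≤ f w) → ‖p - gradient f x‖ ≤ ε := by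
  obtain ⟨q, hq⟩ : ∃ q, q = gradient f x := ⟨_, rfl⟩
  have h1 := (hasGradientAt_iff_isLittleO_nhds_zero.1 h.hasGradientAt).def
    (show (0 : ℝ) < ε / 4 by positivity)
  have hD : ∀ᶠ w in 𝓝 (0 : E), x + w ∈ D := by
    have : Tendsto (fun w : E => x + w) (𝓝 0) (𝓝 x) := by
      simpa using (continuous_const_add x).tendsto 0
    exact this.eventually hx
  obtain ⟨ρ, hρ, hb⟩ := Metric.eventually_nhds_iff.1 (h1.and hD)
  -- If `‖p - q‖ > ε`, a step of length `ρ / 4` along `p - q` gains more than `ε ρ / 4`. The error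
  -- `e` and the first-order remainder cost at most `ε ρ / 16 + ε ρ / 8`.
  refine ⟨min (ρ / 4) (ε / 4 * (ρ / 4)), by positivity, fun z hz hzx p e he hp => ?_⟩
  rw [← hq]
  by_contra! hlt
  have hpq : 0 < ‖p - q‖ := hε.trans hlt
  set u : E := (ρ / 4 / ‖p - q‖) • (p - q)
  have hu : ‖u‖ = ρ / 4 := by
    simp only [u, norm_smul, Real.norm_eq_abs, abs_of_pos (show 0 < ρ / 4 / ‖p - q‖ by positivity)]
    field_simp
  have hz1 : ‖z - x‖ ≤ ρ / 4 := hzx.trans (min_le_left _ _)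
  have he1 : e ≤ ε / 4 * (ρ / 4) := he.trans (min_le_right _ _)
  set w : E := (z - x) + u
  have hw : ‖w‖ ≤ ρ / 2 := (norm_add_le _ _).trans (by linarith)
  obtain ⟨h2, h3⟩ := hb (y := w) (by rw [dist_zero_right]; linarith)
  have h4 := hp _ h3
  have h5 := hf.add_inner_gradient_le (mem_of_mem_nhds hx) hz h
  have h6 := (abs_le.1 h2).2
  have e1 : x + w - z = u := by simp only [w]; abel
  have e2 : inner ℝ q w = inner ℝ q (z - x) + inner ℝ q u := inner_add_right _ _ _
  have e3 : inner ℝ p u - inner ℝ q u = ρ / 4 * ‖p - q‖ := by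
    rw [← inner_sub_left, inner_smul_right, real_inner_self_eq_norm_sq]
    field_simp
  have h7 : ε / 4 * ‖w‖ ≤ ε / 4 * (ρ / 2) := by gcongr
  have h8 : ρ / 4 * ε < ρ / 4 * ‖p - q‖ := by gcongr
  rw [e1] at h4
  rw [← hq] at h5 h6
  rw [e2] at h6
  linarith [mul_pos hρ hε]

theorem ConvexOn.gradient_continuousWithinAt [CompleteSpace E] {D : Set E} {f : E → ℝ}
    (hf : ConvexOn ℝ D f) {x : E} (hx : D ∈ 𝓝 x) (h : DifferentiableAt ℝ f x) :
    ContinuousWithinAt (gradient f) {z ∈ D | DifferentiableAt ℝ f z} x := by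
  rw [Metric.continuousWithinAt_iff]
  intro ε hε
  obtain ⟨δ, hδ, H⟩ := approx_subgradient_near_gradient hf hx h (half_pos hε)
  refine ⟨δ, hδ, fun z hz hzx => ?_⟩
  rw [dist_eq_norm] at *
  refine (H z hz.1 hzx.le _ 0 hδ.le fun w hw => ?_).trans_lt (by linarith)
  simpa using hf.add_inner_gradient_le hz.1 hw hz.2

/-- Convex functions are locally Lipschitz in the interior of their domain, so Rademacher's theorem
applies near each point. -/
theorem ConvexOn.ae_differentiableAt_interior [FiniteDimensional ℝ E] [MeasurableSpace E]
    [BorelSpace E] {μ : Measure E} [μ.IsAddHaarMeasure] {D : Set E} {f : E → ℝ}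
    (hf : ConvexOn ℝ D f) : ∀ᵐ x ∂μ, x ∈ interior D → DifferentiableAt ℝ f x := by
  have : μ {x | x ∈ interior D ∧ ¬ DifferentiableAt ℝ f x} = 0 := by
    refine measure_null_of_locally_null _ fun x hx => ?_
    obtain ⟨C, t, ht, hC⟩ := hf.locallyLipschitzOn_interior hx.1
    rw [isOpen_interior.nhdsWithin_eq hx.1] at ht
    obtain ⟨u, hut, hu, hxu⟩ := mem_nhds_iff.1 ht
    refine ⟨u ∩ {x | x ∈ interior D ∧ ¬ DifferentiableAt ℝ f x},
      inter_mem (mem_nhdsWithin_of_mem_nhds (hu.mem_nhds hxu)) self_mem_nhdsWithin, ?_⟩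
    have h1 := (hC.mono hut).ae_differentiableWithinAt_of_mem (μ := μ)
    refine measure_mono_null (fun z hz => ?_) h1
    simp only [Set.mem_compl_iff, Set.mem_ofPred_eq, not_forall]
    exact ⟨hz.1, fun h => hz.2.2 (h.differentiableAt (hu.mem_nhds hz.1))⟩
  rw [ae_iff]
  simpa using this

end ConvexBasics

/-! ### The resolvent of the subdifferential and its potential. -/

section Alexandrov

variable {E : Type*} [NormedAddCommGroup E] [InnerProductSpace ℝ E]

/-- `J` is the resolvent `(1 + ∂f)⁻¹` of the subdifferential of `f` on `D`. -/
def IsResolvent (D : Set E) (f : E → ℝ) (J : E → E) : Prop :=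
  ∀ y, J y ∈ D ∧ ∀ z ∈ D, f (J y) + inner ℝ (y - J y) (z - J y) ≤ f z

namespace IsResolvent

variable {D : Set E} {f : E → ℝ} {J : E → E}

/-- Firm nonexpansiveness: add the subgradient inequalities at `J y` and `J y'`. -/
theorem norm_sub_sq_le (hJ : IsResolvent D f J) (y y' : E) :
    ‖J y - J y'‖ ^ 2 ≤ inner ℝ (y - y') (J y - J y') := by
  have h1 := (hJ y).2 _ (hJ y').1
  have h2 := (hJ y').2 _ (hJ y).1
  rw [← real_inner_self_eq_norm_sq]
  simp only [inner_sub_left, inner_sub_right] at *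
  linarith [real_inner_comm (J y) (J y')]

theorem norm_sub_le (hJ : IsResolvent D f J) (y y' : E) : ‖J y - J y'‖ ≤ ‖y - y'‖ := by
  have h1 := hJ.norm_sub_sq_le y y'
  have h2 := real_inner_le_norm (y - y') (J y - J y')
  by_contra! h
  nlinarith [norm_nonneg (y - y')]

theorem lipschitzWith (hJ : IsResolvent D f J) : LipschitzWith 1 J :=
  LipschitzWith.of_dist_le_mul fun y y' => by simpa [dist_eq_norm] using hJ.norm_sub_le y y'

theorem apply_add_eq (hJ : IsResolvent D f J) {x p : E} (hx : x ∈ D)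
    (hp : ∀ z ∈ D, f x + inner ℝ p (z - x) ≤ f z) : J (x + p) = x := by
  have h1 := (hJ (x + p)).2 _ hx
  have h2 := hp _ (hJ (x + p)).1
  have h3 : ‖J (x + p) - x‖ ^ 2 ≤ 0 := by
    rw [← real_inner_self_eq_norm_sq]
    simp only [inner_sub_left, inner_sub_right, inner_add_left] at *
    linarith [real_inner_comm (J (x + p)) x]
  have h4 : ‖J (x + p) - x‖ = 0 := by
    have := le_antisymm h3 (by positivity)
    simpa using this
  exact sub_eq_zero.1 (norm_eq_zero.1 h4)

theorem apply_add_gradient [CompleteSpace E] (hJ : IsResolvent D f J) (hf : ConvexOn ℝ D f) {x : E}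
    (hx : x ∈ D) (h : DifferentiableAt ℝ f x) : J (x + gradient f x) = x :=
  hJ.apply_add_eq hx fun _ hz => hf.add_inner_gradient_le hx hz h

/-- The Legendre transform of `f + |·|²/2`, which is a primitive of the resolvent. -/
noncomputable def _root_.resolventPotential (f : E → ℝ) (J : E → E) (y : E) : ℝ :=
  inner ℝ (J y) y - ‖J y‖ ^ 2 / 2 - f (J y)

/-- `J` is a subgradient of the potential at every point (`key`), which is the lower bound.
Exchanging the two points and using that `J` is 1-Lipschitz gives the upper one. -/
theorem potential_bounds (hJ : IsResolvent D f J) (y k : E) :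
    0 ≤ resolventPotential f J (y + k) - resolventPotential f J y - inner ℝ (J y) k ∧
      resolventPotential f J (y + k) - resolventPotential f J y - inner ℝ (J y) k ≤ ‖k‖ ^ 2 := by
  have key : ∀ a b : E, inner ℝ (J a) (b - a) ≤
      resolventPotential f J b - resolventPotential f J a := by
    intro a b
    have h1 := (hJ b).2 _ (hJ a).1
    have h2 : 0 ≤ ‖J b - J a‖ ^ 2 := by positivity
    simp only [resolventPotential, ← real_inner_self_eq_norm_sq, inner_sub_left,
      inner_sub_right] at *
    linarith [real_inner_comm (J a) (J b), real_inner_comm b (J a), real_inner_comm b (J b)]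
  have h1 := key y (y + k)
  have h2 := key (y + k) y
  have h3 : inner ℝ (J (y + k) - J y) k ≤ ‖k‖ * ‖k‖ := by
    refine (real_inner_le_norm _ _).trans ?_
    gcongr
    simpa using hJ.norm_sub_le (y + k) y
  rw [inner_sub_left] at h3
  simp only [add_sub_cancel_left, sub_add_cancel_left, inner_neg_right] at h1 h2
  constructor <;> nlinarith

theorem hasFDerivAt_potential (hJ : IsResolvent D f J) (y : E) :
    HasFDerivAt (resolventPotential f J) (innerSL ℝ (J y)) y := by
  rw [hasFDerivAt_iff_isLittleO_nhds_zero]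
  refine Asymptotics.IsBigO.trans_isLittleO (g := fun k : E => ‖k‖ ^ 2) ?_
    (Asymptotics.isLittleO_norm_pow_id one_lt_two)
  refine Asymptotics.IsBigO.of_bound 1 (Eventually.of_forall fun k => ?_)
  have := hJ.potential_bounds y k
  simp only [innerSL_apply_apply]
  rw [Real.norm_of_nonneg this.1]
  simpa using this.2

theorem isSymmetric_fderiv (hJ : IsResolvent D f J) {y : E} {L : E →L[ℝ] E}
    (hL : HasFDerivAt J L y) : (L : E →ₗ[ℝ] E).IsSymmetric := by
  intro v w
  have h := second_derivative_symmetric hJ.hasFDerivAt_potential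
    (((innerSL ℝ).hasFDerivAt (x := J y)).comp y hL) v w
  simp only [ContinuousLinearMap.comp_apply] at h
  change inner ℝ (L v) w = inner ℝ (L w) v at h
  simpa [real_inner_comm] using h

/-- Second-order expansion of the potential at a point of differentiability of the resolvent. -/
theorem potential_expansion (hJ : IsResolvent D f J) {y : E} {L : E →L[ℝ] E}
    (hL : HasFDerivAt J L y) :
    (fun k : E => resolventPotential f J (y + k) - resolventPotential f J y - inner ℝ (J y) k
      - (1 / 2) * inner ℝ (L k) k) =o[𝓝 0] (fun k : E => ‖k‖ ^ 2) := by
  have hsym := hJ.isSymmetric_fderiv hL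
  have hd : ∀ k : E, HasFDerivAt (fun k : E => resolventPotential f J (y + k)
      - resolventPotential f J y - inner ℝ (J y) k - (1 / 2) * inner ℝ (L k) k)
      (innerSL ℝ (J (y + k) - J y - L k)) k := by
    intro k
    have h1 : HasFDerivAt (fun k => resolventPotential f J (y + k)) (innerSL ℝ (J (y + k))) k :=
      (hasFDerivAt_comp_add_left y).2 (hJ.hasFDerivAt_potential (y + k))
    have h2 : HasFDerivAt (fun k => inner ℝ (J y) k) (innerSL ℝ (J y)) k :=
      (innerSL ℝ (J y)).hasFDerivAt
    have h3 := (L.hasFDerivAt (x := k)).inner ℝ (hasFDerivAt_id k)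
    refine (((h1.sub_const (resolventPotential f J y)).sub h2).sub
      (h3.const_mul (1 / 2))).congr_fderiv (ContinuousLinearMap.ext fun v => ?_)
    have := hsym k v
    simp only [ContinuousLinearMap.coe_coe] at this
    simp
    rw [this, real_inner_comm (L v) k]
    ring
  rw [Asymptotics.isLittleO_iff]
  intro ε hε
  obtain ⟨δ, hδ, hb⟩ := Metric.eventually_nhds_iff.1
    ((hasFDerivAt_iff_isLittleO_nhds_zero.1 hL).def hε)
  filter_upwards [Metric.ball_mem_nhds (0 : E) hδ] with k hk
  -- The gradient `J (y + z) - J y - L z` of the remainder is at most `ε ‖k‖` on the ball of radius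
  -- `‖k‖`; the mean value inequality supplies the second factor `‖k‖`.
  have h := (convex_closedBall (0 : E) ‖k‖).norm_image_sub_le_of_norm_hasFDerivWithin_le
    (C := ε * ‖k‖) (x := 0) (y := k) (fun z _ => (hd z).hasFDerivWithinAt) (fun z hz => ?_)
    (by simp) (by simp)
  · simp only [add_zero, sub_self, inner_zero_right, map_zero, mul_zero, sub_zero] at h
    refine h.trans (le_of_eq ?_)
    simp
    ring
  · rw [innerSL_apply_norm]
    have hz' : ‖z‖ ≤ ‖k‖ := by simpa using hz
    refine (hb ?_).trans (by gcongr)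
    simp only [Metric.mem_ball, dist_zero_right] at hk ⊢
    linarith

end IsResolvent

end Alexandrov

/-! ### Alexandrov's theorem by inverting the resolvent. -/

section AlexandrovTheorem

variable {E : Type*} [NormedAddCommGroup E] [InnerProductSpace ℝ E]

theorem LipschitzWith.addHaar_image_eq_zero [FiniteDimensional ℝ E] [MeasurableSpace E]
    [BorelSpace E] {μ : Measure E} [μ.IsAddHaarMeasure] {K : NNReal} {f : E → E}
    (hf : LipschitzWith K f) {s : Set E} (hs : μ s = 0) : μ (f '' s) = 0 := by
  have h1 : (Measure.hausdorffMeasure (Module.finrank ℝ E) : Measure E) s = 0 :=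
    Measure.absolutelyContinuous_isAddHaarMeasure _ μ hs
  have h2 := hf.hausdorffMeasure_image_le (d := Module.finrank ℝ E) (by positivity) s
  rw [h1, mul_zero] at h2
  exact Measure.absolutelyContinuous_isAddHaarMeasure μ
    (Measure.hausdorffMeasure (Module.finrank ℝ E) : Measure E) (le_antisymm h2 zero_le)

namespace IsResolvent

variable {D : Set E} {f : E → ℝ} {J : E → E}

theorem _root_.eq_inner_sub_resolventPotential {y x : E} (h : J y = x) :
    f x = inner ℝ x y - ‖x‖ ^ 2 / 2 - resolventPotential f J y := by
  simp [resolventPotential, h]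

/-- `J` inverts `z ↦ z + ∇f(z)`, which is continuous at `x` along points of differentiability. Hence
the latter map has derivative `L⁻¹` there. -/
theorem hasFDerivWithinAt_gradient [FiniteDimensional ℝ E] (hJ : IsResolvent D f J)
    (hf : ConvexOn ℝ D f) {x : E} (hx : x ∈ interior D) (hd : DifferentiableAt ℝ f x)
    {L : E ≃L[ℝ] E} (hL : HasFDerivAt J (L : E →L[ℝ] E) (x + gradient f x)) :
    HasFDerivWithinAt (gradient f) ((L.symm : E →L[ℝ] E) - ContinuousLinearMap.id ℝ E)
      {z ∈ D | DifferentiableAt ℝ f z} x := by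
  have hxD := interior_subset hx
  have hc : ContinuousWithinAt (fun z => z + gradient f z) {z ∈ D | DifferentiableAt ℝ f z} x :=
    continuousWithinAt_id.add
      (hf.gradient_continuousWithinAt (mem_interior_iff_mem_nhds.1 hx) hd)
  have h1 := HasFDerivWithinAt.of_local_left_inverse (t := Set.univ) (f := J)
    (g := fun z => z + gradient f z) (a := x) (s := {z ∈ D | DifferentiableAt ℝ f z}) (f' := L)
    (by rw [nhdsWithin_univ]; exact hc) hL.hasFDerivWithinAt ⟨hxD, hd⟩
    (by filter_upwards [self_mem_nhdsWithin] with z hz using hJ.apply_add_gradient hf hz.1 hz.2)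
  have h2 := h1.sub (hasFDerivWithinAt_id x _)
  refine h2.congr (fun z _ => ?_) ?_ <;> simp

/-- Fenchel's equality expresses `f(z)` through the potential at `z + ∇f(z)`. With `h = z - x` and
`k` the increment of `z + ∇f(z)`, replacing `k` by `L⁻¹h` has no first-order cost: the error `e = k
- L⁻¹h` enters only as `½ Le · e`, which is `o(‖h‖²)`. -/
theorem expansion_within [FiniteDimensional ℝ E] (hJ : IsResolvent D f J)
    (hf : ConvexOn ℝ D f) {x : E} (hx : x ∈ interior D) (hd : DifferentiableAt ℝ f x)
    {L : E ≃L[ℝ] E} (hL : HasFDerivAt J (L : E →L[ℝ] E) (x + gradient f x)) :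
    (fun z => f z - f x - inner ℝ (gradient f x) (z - x)
      - (1 / 2) * inner ℝ ((L.symm : E →L[ℝ] E) (z - x) - (z - x)) (z - x))
      =o[𝓝[{z ∈ D | DifferentiableAt ℝ f z}] x] (fun z => ‖z - x‖ ^ 2) := by
  set G := {z ∈ D | DifferentiableAt ℝ f z}
  have hsym := hJ.isSymmetric_fderiv hL
  have hxD := interior_subset hx
  have hg := hJ.hasFDerivWithinAt_gradient hf hx hd hL
  obtain ⟨p, hp⟩ : ∃ p, p = gradient f x := ⟨_, rfl⟩
  set k : E → E := fun z => z + gradient f z - (x + gradient f x)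
  have hk : (fun z => k z - L.symm (z - x)) =o[𝓝[G] x] (fun z => z - x) := by
    refine (hg.isLittleO).congr_left fun z => ?_
    simp [k]
    abel
  have hk1 : k =O[𝓝[G] x] (fun z => z - x) := by
    have h1 : (fun z => L.symm (z - x)) =O[𝓝[G] x] (fun z => z - x) :=
      (L.symm : E →L[ℝ] E).isBigO_comp _ _
    simpa using hk.isBigO.add h1
  have hk0 : Tendsto k (𝓝[G] x) (𝓝 0) := by
    refine hk1.trans_tendsto ?_
    have : Tendsto (fun z => z - x) (𝓝 x) (𝓝 0) := by
      simpa using (continuous_sub_right x).tendsto x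
    exact this.mono_left nhdsWithin_le_nhds
  have hr := ((hJ.potential_expansion hL).comp_tendsto hk0).trans_isBigO (hk1.norm_norm.pow 2)
  have hLe : (fun z => (1 / 2 : ℝ) * inner ℝ (L (k z - L.symm (z - x))) (k z - L.symm (z - x)))
      =o[𝓝[G] x] (fun z => ‖z - x‖ ^ 2) := by
    have h1 : (fun z => (1 / 2 : ℝ) * inner ℝ (L (k z - L.symm (z - x))) (k z - L.symm (z - x)))
        =O[𝓝[G] x] (fun z => ‖k z - L.symm (z - x)‖ ^ 2) := by
      refine Asymptotics.IsBigO.of_bound (‖(L : E →L[ℝ] E)‖ / 2) (Eventually.of_forall fun z => ?_)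
      have h2 := norm_inner_le_norm (𝕜 := ℝ) (L (k z - L.symm (z - x))) (k z - L.symm (z - x))
      have h3 := (L : E →L[ℝ] E).le_opNorm (k z - L.symm (z - x))
      have h4 := norm_nonneg (k z - L.symm (z - x))
      rw [norm_mul, Real.norm_of_nonneg (show (0 : ℝ) ≤ 1 / 2 by norm_num), norm_pow, norm_norm]
      simp only [ContinuousLinearEquiv.coe_coe] at h3
      nlinarith
    exact h1.trans_isLittleO (hk.norm_norm.pow two_pos)
  refine ((hr.add hLe).neg_left).congr' ?_ EventuallyEq.rfl
  filter_upwards [self_mem_nhdsWithin] with z hz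
  have e0 := eq_inner_sub_resolventPotential (f := f) (hJ.apply_add_gradient hf hxD hd)
  have e1 := eq_inner_sub_resolventPotential (f := f) (hJ.apply_add_gradient hf hz.1 hz.2)
  have e2 : z + gradient f z = x + gradient f x + k z := by simp [k]
  obtain ⟨h, hh⟩ : ∃ h, h = z - x := ⟨_, rfl⟩
  obtain ⟨e, he⟩ : ∃ e, e = k z - L.symm h := ⟨_, rfl⟩
  obtain ⟨m, hm⟩ : ∃ m, m = L.symm h := ⟨_, rfl⟩
  have hLm : L m = h := by simp [hm]
  have hz' : z = x + h := by simp [hh]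
  have hk' : k z = m + e := by simp [he, hm]
  have hs1 := hsym e m
  have hs2 := hsym m e
  simp only [ContinuousLinearMap.coe_coe, ContinuousLinearEquiv.coe_coe, hLm] at hs1 hs2
  rw [e2] at e1
  rw [e1, e0, hJ.apply_add_gradient hf hxD hd]
  simp only [Function.comp, ← hh, hk', ← hm, ContinuousLinearEquiv.coe_coe]
  rw [← hp, hz']
  simp only [← real_inner_self_eq_norm_sq, inner_add_left, inner_add_right, inner_sub_left,
    map_add, hLm, add_sub_cancel_left]
  rw [real_inner_comm h x, real_inner_comm h p, real_inner_comm m h]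
  linarith [real_inner_comm e h]

theorem expansion [FiniteDimensional ℝ E] [MeasurableSpace E]
    [BorelSpace E] (hJ : IsResolvent D f J)
    (hf : ConvexOn ℝ D f) {x : E} (hx : x ∈ interior D) (hd : DifferentiableAt ℝ f x)
    {L : E ≃L[ℝ] E} (hL : HasFDerivAt J (L : E →L[ℝ] E) (x + gradient f x)) :
    (fun h => f (x + h) - f x - inner ℝ (gradient f x) h
      - (1 / 2) * inner ℝ ((L.symm : E →L[ℝ] E) h - h) h) =o[𝓝 0] (fun h => ‖h‖ ^ 2) := by
  rw [Asymptotics.isLittleO_iff]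
  intro ε hε
  have h1 := (hJ.expansion_within hf hx hd hL).def hε
  obtain ⟨δ, hδ, hb⟩ := Metric.mem_nhdsWithin_iff.1 h1
  have h2 : Metric.ball x δ ∩ interior D ∈ 𝓝 x :=
    inter_mem (Metric.ball_mem_nhds x hδ) (isOpen_interior.mem_nhds hx)
  have h3 : Tendsto (fun h : E => x + h) (𝓝 0) (𝓝 x) := by
    simpa using (continuous_const_add x).tendsto 0
  filter_upwards [h3 h2] with h hh
  -- The bound is a non-strict inequality between continuous functions, so it passes from the dense
  -- set of differentiability points to all nearby points.
  have hdense : Dense {z | z ∈ interior D → DifferentiableAt ℝ f z} :=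
    Measure.dense_of_ae (hf.ae_differentiableAt_interior (μ := Measure.addHaar))
  have hcl := hdense.open_subset_closure_inter (Metric.isOpen_ball.inter isOpen_interior) hh
  have hcf : ContinuousAt f (x + h) :=
    hf.continuousOn_interior.continuousAt (isOpen_interior.mem_nhds hh.2)
  have := ContinuousWithinAt.closure_le hcl
    (f := fun z => ‖f z - f x - inner ℝ (gradient f x) (z - x)
      - (1 / 2) * inner ℝ ((L.symm : E →L[ℝ] E) (z - x) - (z - x)) (z - x)‖)
    (g := fun z => ε * ‖‖z - x‖ ^ 2‖)
    (ContinuousAt.continuousWithinAt (by fun_prop))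
    (ContinuousAt.continuousWithinAt (by fun_prop))
    (fun z hz => hb ⟨hz.1.1, interior_subset hz.1.2, hz.2 hz.1.2⟩)
  simpa only [add_sub_cancel_left] using this

/-- Alexandrov's theorem: a convex function whose subdifferential has a resolvent is twice
differentiable almost everywhere, and the Hessian is the derivative of the gradient. -/
theorem ae_exists_hessian [FiniteDimensional ℝ E] [MeasurableSpace E]
    [BorelSpace E] {μ : Measure E} [μ.IsAddHaarMeasure] (hJ : IsResolvent D f J)
    (hf : ConvexOn ℝ D f) :
    ∀ᵐ x ∂μ, x ∈ interior D → DifferentiableAt ℝ f x ∧ ∃ A : E →L[ℝ] E,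
      (A : E →ₗ[ℝ] E).IsSymmetric ∧
      HasFDerivWithinAt (gradient f) A {z ∈ D | DifferentiableAt ℝ f z} x ∧
      (fun h => f (x + h) - f x - inner ℝ (gradient f x) h - (1 / 2) * inner ℝ (A h) h)
        =o[𝓝 0] (fun h => ‖h‖ ^ 2) := by
  -- The images under `J` of both bad sets are null: for `N` by Rademacher and the Lipschitz bound,
  -- for `C` by Sard.
  set N := {y | ¬ DifferentiableAt ℝ J y}
  set C := {y | DifferentiableAt ℝ J y ∧ (fderiv ℝ J y).det = 0}
  have hN : μ (J '' N) = 0 :=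
    hJ.lipschitzWith.addHaar_image_eq_zero (ae_iff.1 (hJ.lipschitzWith.ae_differentiableAt))
  have hC : μ (J '' C) = 0 := addHaar_image_eq_zero_of_det_fderivWithin_eq_zero (f' := fderiv ℝ J) μ
    (fun y hy => hy.1.hasFDerivAt.hasFDerivWithinAt) (fun y hy => hy.2)
  filter_upwards [hf.ae_differentiableAt_interior (μ := μ), measure_eq_zero_iff_ae_notMem.1 hN,
    measure_eq_zero_iff_ae_notMem.1 hC] with x hd hxN hxC hx
  have hd := hd hx
  have hJx := hJ.apply_add_gradient hf (interior_subset hx) hd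
  have h1 : DifferentiableAt ℝ J (x + gradient f x) := by
    by_contra h
    exact hxN ⟨_, h, hJx⟩
  have h2 : (fderiv ℝ J (x + gradient f x)).det ≠ 0 := fun h => hxC ⟨_, ⟨h1, h⟩, hJx⟩
  obtain ⟨L, hL⟩ : ∃ L : E ≃L[ℝ] E, (L : E →L[ℝ] E) = fderiv ℝ J (x + gradient f x) :=
    ⟨ContinuousLinearMap.toContinuousLinearEquivOfDetNeZero _ h2,
      ContinuousLinearMap.coe_toContinuousLinearEquivOfDetNeZero _ h2⟩
  have hJL : HasFDerivAt J (L : E →L[ℝ] E) (x + gradient f x) := hL ▸ h1.hasFDerivAt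
  have hsym := hJ.isSymmetric_fderiv hJL
  refine ⟨hd, _, fun v w => ?_, hJ.hasFDerivWithinAt_gradient hf hx hd hJL,
    hJ.expansion hf hx hd hJL⟩
  have := hsym (L.symm v) (L.symm w)
  simp only [ContinuousLinearMap.coe_coe, ContinuousLinearEquiv.coe_coe,
    ContinuousLinearEquiv.apply_symm_apply] at this
  simp [inner_sub_left, inner_sub_right, this]

end IsResolvent

end AlexandrovTheorem

/-! ### Existence of the resolvent; finite parts of Legendre transforms. -/

section ExtendedReal

variable {d : ℕ}

theorem coe_finPart {ψ : Euc d → EReal} (hψ : IsProper ψ) {x : Euc d} (hx : ψ x ≠ ⊤) :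
    (finPart ψ x : EReal) = ψ x := EReal.coe_toReal hx (hψ.1 x)

theorem IsConvexFn.convexOn_finPart {ψ : Euc d → EReal} (hψ : IsProper ψ) (hc : IsConvexFn ψ) :
    ConvexOn ℝ {x | ψ x ≠ ⊤} (finPart ψ) := by
  have key : ∀ x, ψ x ≠ ⊤ → ∀ y, ψ y ≠ ⊤ → ∀ a b : ℝ, 0 ≤ a → 0 ≤ b → a + b = 1 →
      ψ (a • x + b • y) ≤ ((a • finPart ψ x + b • finPart ψ y : ℝ) : EReal) := by
    intro x hx y hy a b ha hb hab
    exact hc (x := (x, finPart ψ x)) (by simp [coe_finPart hψ hx]) (y := (y, finPart ψ y))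
      (by simp [coe_finPart hψ hy]) ha hb hab
  refine ⟨fun x hx y hy a b ha hb hab => ?_, fun x hx y hy a b ha hb hab => ?_⟩
  · exact ((key x hx y hy a b ha hb hab).trans_lt (EReal.coe_lt_top _)).ne
  · have h := key x hx y hy a b ha hb hab
    have h1 : ψ (a • x + b • y) ≠ ⊤ := (h.trans_lt (EReal.coe_lt_top _)).ne
    rw [← coe_finPart hψ h1] at h
    exact_mod_cast h

/-- The affine minorant makes `ψ + ‖· - y‖² / 2` coercive. The minimizer will be the value of the
resolvent at `y`. -/
theorem exists_isMinOn_add_sq {ψ : Euc d → EReal} (hψ : IsProper ψ) (hl : LowerSemicontinuous ψ)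
    {y₀ : Euc d} {c₀ : ℝ} (hm : ∀ x, ψ x ≠ ⊤ → inner ℝ x y₀ - c₀ ≤ finPart ψ x) (y : Euc d) :
    ∃ x, ψ x ≠ ⊤ ∧ ∀ z, ψ z ≠ ⊤ →
      finPart ψ x + ‖x - y‖ ^ 2 / 2 ≤ finPart ψ z + ‖z - y‖ ^ 2 / 2 := by
  set g : Euc d → EReal := fun x => ψ x + ((‖x - y‖ ^ 2 / 2 : ℝ) : EReal)
  have hg : LowerSemicontinuous g := by
    refine hl.add' (Continuous.lowerSemicontinuous ?_) fun x => ?_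
    · exact continuous_coe_real_ereal.comp (by fun_prop)
    · exact EReal.continuousAt_add (Or.inr (EReal.coe_ne_bot _)) (Or.inr (EReal.coe_ne_top _))
  have hgc : ∀ x, ψ x ≠ ⊤ → g x = ((finPart ψ x + ‖x - y‖ ^ 2 / 2 : ℝ) : EReal) := by
    intro x hx
    simp only [g]
    rw [← coe_finPart hψ hx]
    norm_cast
  obtain ⟨x₁, hx₁⟩ := hψ.2
  set v := finPart ψ x₁ + ‖x₁ - y‖ ^ 2 / 2
  set K := v - (inner ℝ y y₀ - c₀)
  -- This radius puts the competitor `x₁` in the ball and makes the quadratic term beat the affine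
  -- minorant outside it.
  set R := 2 * ‖y₀‖ + 2 + 2 * |K| + ‖x₁ - y‖
  obtain ⟨x, hxR, hx⟩ := LowerSemicontinuousOn.exists_isMinOn (s := Metric.closedBall y R) (f := g)
    ⟨x₁, by
      simp only [Metric.mem_closedBall, dist_eq_norm, R]
      linarith [norm_nonneg y₀, abs_nonneg K]⟩
    (isCompact_closedBall y R) (hg.lowerSemicontinuousOn _)
  have hx₁R : x₁ ∈ Metric.closedBall y R := by
    simp only [Metric.mem_closedBall, dist_eq_norm, R]
    linarith [norm_nonneg y₀, abs_nonneg K]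
  have hgx : g x ≤ v := by
    have : g x ≤ g x₁ := hx hx₁R
    rwa [hgc x₁ hx₁] at this
  have hxt : ψ x ≠ ⊤ := by
    intro h
    simp [g, h] at hgx
  refine ⟨x, hxt, fun z hz => ?_⟩
  by_cases hzR : z ∈ Metric.closedBall y R
  · have : g x ≤ g z := hx hzR
    rw [hgc x hxt, hgc z hz] at this
    exact_mod_cast this
  · rw [hgc x hxt] at hgx
    have h1 : finPart ψ x + ‖x - y‖ ^ 2 / 2 ≤ v := by exact_mod_cast hgx
    refine h1.trans ?_
    have h2 := hm z hz
    obtain ⟨w, hw⟩ : ∃ w, w = z - y := ⟨_, rfl⟩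
    have h3 : inner ℝ z y₀ = inner ℝ y y₀ + inner ℝ w y₀ := by
      rw [← inner_add_left, hw, add_sub_cancel]
    have h4 := (abs_le.1 (abs_real_inner_le_norm w y₀)).1
    have h5 : R < ‖w‖ := by
      simpa [Metric.mem_closedBall, dist_eq_norm, hw] using hzR
    rw [← hw]
    have h6 : K ≤ ‖w‖ * (‖w‖ / 2 - ‖y₀‖) := by
      have h7 : |K| + 1 ≤ ‖w‖ / 2 - ‖y₀‖ := by
        simp only [R] at h5
        linarith [norm_nonneg (x₁ - y)]
      have h8 : 1 ≤ ‖w‖ := by linarith [norm_nonneg y₀, abs_nonneg K]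
      nlinarith [le_abs_self K, abs_nonneg K]
    simp only [K] at h6
    nlinarith

theorem exists_isResolvent {ψ : Euc d → EReal} (hψ : IsProper ψ) (hl : LowerSemicontinuous ψ)
    (hc : IsConvexFn ψ) {y₀ : Euc d} {c₀ : ℝ}
    (hm : ∀ x, ψ x ≠ ⊤ → inner ℝ x y₀ - c₀ ≤ finPart ψ x) :
    ∃ J, IsResolvent {x | ψ x ≠ ⊤} (finPart ψ) J := by
  choose J hJ hJ' using exists_isMinOn_add_sq hψ hl hm
  refine ⟨J, fun y => ⟨hJ y, fun z hz => ?_⟩⟩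
  have hconv := hc.convexOn_finPart hψ
  set f := finPart ψ
  set x := J y
  by_contra! h
  obtain ⟨a, ha⟩ : ∃ a, a = f x + inner ℝ (y - x) (z - x) - f z := ⟨_, rfl⟩
  have ha0 : 0 < a := by linarith
  obtain ⟨b, hb⟩ : ∃ b, b = ‖z - x‖ ^ 2 := ⟨_, rfl⟩
  have hb0 : 0 ≤ b := by rw [hb]; positivity
  -- First-order condition for the minimizer: compare it with the point at parameter `t` on the
  -- segment to `z` and divide by `t`.
  have key : ∀ t : ℝ, 0 < t → t ≤ 1 → a ≤ t * b / 2 := by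
    intro t ht ht1
    have hmem := hconv.1 (hJ y) hz (sub_nonneg.2 ht1) ht.le (by ring)
    have h1 := hJ' y _ hmem
    have h2 := hconv.2 (hJ y) hz (sub_nonneg.2 ht1) ht.le (by ring)
    have e1 : (1 - t) • x + t • z - y = (x - y) + t • (z - x) := by module
    have e2 : inner ℝ (y - x) (z - x) = - inner ℝ (x - y) (z - x) := by
      rw [← inner_neg_left, neg_sub]
    rw [show J y = x from rfl, e1, norm_add_sq_real, inner_smul_right, norm_smul,
      Real.norm_of_nonneg ht.le, mul_pow, ← hb] at h1
    simp only [smul_eq_mul] at h2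
    rw [show J y = x from rfl] at h2
    have h3 : t * a ≤ t * (t * b / 2) := by
      rw [ha, e2]
      nlinarith
    exact le_of_mul_le_mul_left h3 ht
  have h1 := key (min 1 (a / (b + 1))) (by positivity) (min_le_left _ _)
  have h2 : min 1 (a / (b + 1)) * b ≤ a / (b + 1) * b := by gcongr; exact min_le_right _ _
  have h3 : a / (b + 1) * b ≤ a := by
    rw [div_mul_eq_mul_div, div_le_iff₀ (by positivity)]
    nlinarith
  linarith

theorem inner_sub_le_legendre {φ : Euc d → EReal} (hp : IsProper (legendre φ)) {x y : Euc d}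
    (hx : legendre φ x ≠ ⊤) (hb : φ y ≠ ⊥) (ht : φ y ≠ ⊤) :
    inner ℝ x y - (φ y).toReal ≤ finPart (legendre φ) x := by
  have h : ((inner ℝ x y : ℝ) : EReal) - φ y ≤ legendre φ x :=
    le_iSup (fun y => ((inner ℝ x y : ℝ) : EReal) - φ y) y
  rw [← coe_finPart hp hx, ← EReal.coe_toReal ht hb] at h
  exact_mod_cast h

theorem exists_legendre_sub_lt {φ : Euc d → EReal} (hp : IsProper (legendre φ)) {x : Euc d}
    (hx : legendre φ x ≠ ⊤) (hb : ∀ y, φ y ≠ ⊥) {e : ℝ} (he : 0 < e) :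
    ∃ y, φ y ≠ ⊤ ∧ finPart (legendre φ) x - e < inner ℝ x y - (φ y).toReal := by
  have h : ((finPart (legendre φ) x - e : ℝ) : EReal) < legendre φ x := by
    rw [← coe_finPart hp hx]
    exact_mod_cast sub_lt_self _ he
  obtain ⟨y, hy⟩ := lt_iSup_iff.1 h
  have ht : φ y ≠ ⊤ := by
    intro h
    simp [h] at hy
  refine ⟨y, ht, ?_⟩
  rw [← EReal.coe_toReal ht (hb y)] at hy
  exact_mod_cast hy

end ExtendedReal

/-! ### Radial test functions and averaging kernels. -/

section RadialKernel

/-- A smooth antitone profile that vanishes on `[1, ∞)`. -/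
noncomputable def radialProfile (s : ℝ) : ℝ := 1 - Real.smoothTransition s

/-- The primitive of `-radialProfile` that vanishes on `[1, ∞)`. -/
noncomputable def radialPrimitive (s : ℝ) : ℝ := ∫ t in s..1, radialProfile t

theorem contDiff_radialProfile : ContDiff ℝ ∞ radialProfile :=
  contDiff_const.sub Real.smoothTransition.contDiff

theorem continuous_radialProfile : Continuous radialProfile := contDiff_radialProfile.continuous

theorem antitone_radialProfile : Antitone radialProfile := fun _ _ h =>
  sub_le_sub_left (Real.smoothTransition.monotone h) _

theorem radialProfile_nonneg (s : ℝ) : 0 ≤ radialProfile s :=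
  sub_nonneg.2 (Real.smoothTransition.le_one s)

theorem radialProfile_le_one (s : ℝ) : radialProfile s ≤ 1 :=
  sub_le_self _ (Real.smoothTransition.nonneg s)

theorem radialProfile_of_one_le {s : ℝ} (h : 1 ≤ s) : radialProfile s = 0 := by
  simp [radialProfile, Real.smoothTransition.one_of_one_le h]

theorem radialProfile_pos {s : ℝ} (h : s < 1) : 0 < radialProfile s :=
  sub_pos.2 (Real.smoothTransition.lt_one_of_lt_one h)

theorem hasDerivAt_radialProfile (s : ℝ) :
    HasDerivAt radialProfile (deriv radialProfile s) s :=
  (contDiff_radialProfile.differentiable (by simp) s).hasDerivAt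

theorem continuous_deriv_radialProfile : Continuous (deriv radialProfile) :=
  contDiff_radialProfile.continuous_deriv (by simp)

theorem hasDerivAt_radialPrimitive (s : ℝ) :
    HasDerivAt radialPrimitive (-radialProfile s) s :=
  intervalIntegral.integral_hasDerivAt_left
    (continuous_radialProfile.intervalIntegrable _ _)
    continuous_radialProfile.stronglyMeasurable.stronglyMeasurableAtFilter
    continuous_radialProfile.continuousAt

theorem contDiff_radialPrimitive : ContDiff ℝ ∞ radialPrimitive := by
  rw [contDiff_infty_iff_deriv]
  refine ⟨fun s => (hasDerivAt_radialPrimitive s).differentiableAt, ?_⟩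
  rw [funext fun s => (hasDerivAt_radialPrimitive s).deriv]
  exact contDiff_radialProfile.neg

theorem radialPrimitive_of_one_le {s : ℝ} (h : 1 ≤ s) : radialPrimitive s = 0 := by
  rw [radialPrimitive, intervalIntegral.integral_symm, intervalIntegral.integral_congr
    (g := fun _ => (0 : ℝ)) fun t ht => ?_]
  · simp
  · rw [Set.uIcc_of_le h] at ht
    exact radialProfile_of_one_le ht.1

theorem radialPrimitive_nonneg (s : ℝ) : 0 ≤ radialPrimitive s := by
  rcases le_total s 1 with h | h
  · exact intervalIntegral.integral_nonneg h fun t _ => radialProfile_nonneg t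
  · exact (radialPrimitive_of_one_le h).ge

theorem radialPrimitive_zero_pos : 0 < radialPrimitive 0 :=
  intervalIntegral.intervalIntegral_pos_of_pos_on
    (continuous_radialProfile.intervalIntegrable _ _) (fun _ ht => radialProfile_pos ht.2) one_pos

variable {d : ℕ}

/-- The radial test function of radius `r` around `y`. -/
noncomputable def radialBump (y : Euc d) (r : ℝ) (z : Euc d) : ℝ :=
  radialPrimitive (‖z - y‖ ^ 2 / r ^ 2) / 2

/-- The radial averaging kernel of radius `r` around `y`. -/
noncomputable def radialKernel (y : Euc d) (r : ℝ) (z : Euc d) : ℝ :=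
  (r ^ d)⁻¹ * radialProfile (‖z - y‖ ^ 2 / r ^ 2)

theorem one_le_sq_div_sq {y z : Euc d} {r : ℝ} (hr : 0 < r) (h : r ≤ ‖z - y‖) :
    1 ≤ ‖z - y‖ ^ 2 / r ^ 2 := by
  rw [one_le_div (by positivity)]
  gcongr

theorem contDiff_radialBump (y : Euc d) (r : ℝ) : ContDiff ℝ ∞ (radialBump y r) := by
  have h : ContDiff ℝ ∞ fun z : Euc d => ‖z - y‖ ^ 2 / r ^ 2 :=
    ((contDiff_id.sub contDiff_const).norm_sq ℝ).div_const _
  exact (contDiff_radialPrimitive.comp h).div_const _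

theorem radialBump_nonneg (y : Euc d) (r : ℝ) (z : Euc d) : 0 ≤ radialBump y r z :=
  div_nonneg (radialPrimitive_nonneg _) two_pos.le

theorem radialBump_eq_zero {y z : Euc d} {r : ℝ} (hr : 0 < r) (h : r ≤ ‖z - y‖) :
    radialBump y r z = 0 := by
  rw [radialBump, radialPrimitive_of_one_le (one_le_sq_div_sq hr h), zero_div]

theorem radialKernel_eq_zero {y z : Euc d} {r : ℝ} (hr : 0 < r) (h : r ≤ ‖z - y‖) :
    radialKernel y r z = 0 := by
  rw [radialKernel, radialProfile_of_one_le (one_le_sq_div_sq hr h), mul_zero]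

theorem radialKernel_nonneg (y : Euc d) {r : ℝ} (hr : 0 < r) (z : Euc d) :
    0 ≤ radialKernel y r z :=
  mul_nonneg (by positivity) (radialProfile_nonneg _)

theorem continuous_radialKernel (y : Euc d) (r : ℝ) : Continuous (radialKernel y r) :=
  continuous_const.mul (continuous_radialProfile.comp (by fun_prop))

theorem tsupport_radialBump_subset (y : Euc d) {r : ℝ} (hr : 0 < r) :
    tsupport (radialBump y r) ⊆ Metric.closedBall y r := by
  refine closure_minimal (fun z hz => ?_) Metric.isClosed_closedBall
  by_contra h
  rw [Metric.mem_closedBall, dist_eq_norm, not_le] at h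
  exact hz (radialBump_eq_zero hr h.le)

theorem hasCompactSupport_radialBump (y : Euc d) {r : ℝ} (hr : 0 < r) :
    HasCompactSupport (radialBump y r) :=
  (isCompact_closedBall y r).of_isClosed_subset (isClosed_tsupport _)
    (tsupport_radialBump_subset y hr)

theorem hasCompactSupport_radialKernel (y : Euc d) {r : ℝ} (hr : 0 < r) :
    HasCompactSupport (radialKernel y r) :=
  HasCompactSupport.intro (isCompact_closedBall y r) fun z hz => by
    rw [Metric.mem_closedBall, dist_eq_norm, not_le] at hz
    exact radialKernel_eq_zero hr hz.le

theorem hasFDerivAt_sq_div (y z : Euc d) (r : ℝ) :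
    HasFDerivAt (fun z : Euc d => ‖z - y‖ ^ 2 / r ^ 2) ((2 / r ^ 2) • innerSL ℝ (z - y)) z := by
  have h := (((hasFDerivAt_id z).sub_const y).norm_sq).mul_const ((r ^ 2)⁻¹)
  simp only [← div_eq_mul_inv] at h
  refine h.congr_fderiv (ContinuousLinearMap.ext fun v => ?_)
  simp
  ring

theorem hasFDerivAt_radialBump (y z : Euc d) (r : ℝ) :
    HasFDerivAt (radialBump y r)
      ((-(radialProfile (‖z - y‖ ^ 2 / r ^ 2) / r ^ 2)) • innerSL ℝ (z - y)) z := by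
  have h := ((hasDerivAt_radialPrimitive _).comp_hasFDerivAt z
    (hasFDerivAt_sq_div y z r)).mul_const (1 / 2)
  refine (h.congr_fderiv (ContinuousLinearMap.ext fun v => ?_)).congr_of_eventuallyEq
    (Eventually.of_forall fun z => ?_)
  · simp
    ring
  · simp [radialBump, div_eq_mul_inv]

theorem fderiv_fderiv_radialBump_apply (y z : Euc d) (r : ℝ) (v : Euc d) :
    fderiv ℝ (fderiv ℝ (radialBump y r)) z v v =
      -(radialProfile (‖z - y‖ ^ 2 / r ^ 2) / r ^ 2) * ‖v‖ ^ 2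
        - deriv radialProfile (‖z - y‖ ^ 2 / r ^ 2) / r ^ 2 * (2 / r ^ 2)
          * inner ℝ (z - y) v ^ 2 := by
  have h1 : fderiv ℝ (radialBump y r) = fun z =>
      (-(radialProfile (‖z - y‖ ^ 2 / r ^ 2) / r ^ 2)) • innerSL ℝ (z - y) :=
    funext fun z => (hasFDerivAt_radialBump y z r).fderiv
  have h2 : HasFDerivAt (fun z : Euc d => -(radialProfile (‖z - y‖ ^ 2 / r ^ 2) / r ^ 2))
      ((-(deriv radialProfile (‖z - y‖ ^ 2 / r ^ 2) / r ^ 2) * (2 / r ^ 2)) • innerSL ℝ (z - y))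
      z := by
    have h := (((hasDerivAt_radialProfile _).comp_hasFDerivAt z
      (hasFDerivAt_sq_div y z r)).mul_const ((r ^ 2)⁻¹)).neg
    refine h.congr_fderiv (ContinuousLinearMap.ext fun v => ?_)
    simp
    ring
  have h3 : HasFDerivAt (fun z : Euc d => innerSL ℝ (z - y)) (innerSL ℝ) z := by
    simp only [map_sub]
    exact ((innerSL ℝ (E := Euc d)).hasFDerivAt (x := z)).sub_const (innerSL ℝ y)
  have h4 : fderiv ℝ (fun z => (-(radialProfile (‖z - y‖ ^ 2 / r ^ 2) / r ^ 2))
      • innerSL ℝ (z - y)) z = _ := (h2.smul h3).fderiv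
  rw [h1, h4, add_apply, add_apply,
    ContinuousLinearMap.smulRight_apply, smul_apply,
    smul_apply, smul_apply,
    smul_apply, innerSL_apply_apply, innerSL_apply_apply,
    real_inner_self_eq_norm_sq]
  simp only [smul_eq_mul]
  ring

theorem laplacian_radialBump (y z : Euc d) (r : ℝ) :
    Laplacian.laplacian (radialBump y r) z =
      -(d * radialProfile (‖z - y‖ ^ 2 / r ^ 2) / r ^ 2
        + 2 * (‖z - y‖ ^ 2 / r ^ 2) * deriv radialProfile (‖z - y‖ ^ 2 / r ^ 2) / r ^ 2) := by
  have b : OrthonormalBasis (Fin d) ℝ (Euc d) := EuclideanSpace.basisFun (Fin d) ℝ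
  rw [laplacian_eq_iteratedFDeriv_orthonormalBasis _ b]
  have h (i : Fin d) : iteratedFDeriv ℝ 2 (radialBump y r) z ![b i, b i] = _ :=
    (iteratedFDeriv_two_apply _ _ _).trans (fderiv_fderiv_radialBump_apply y z r (b i))
  simp only [h, b.norm_eq_one]
  rw [Finset.sum_sub_distrib, ← Finset.mul_sum, ← Finset.mul_sum, b.sum_sq_inner_left]
  simp
  ring

end RadialKernel

/-! ### Monotonicity of radial means. -/

section RadialIntegrals

variable {d : ℕ}

theorem deriv_radialProfile_of_one_lt {s : ℝ} (h : 1 < s) : deriv radialProfile s = 0 := by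
  have : radialProfile =ᶠ[𝓝 s] fun _ => 0 := by
    filter_upwards [lt_mem_nhds h] with t ht using radialProfile_of_one_le ht.le
  rw [this.deriv_eq, deriv_const]

theorem laplacian_radialBump_eq_zero {y z : Euc d} {r : ℝ} (hr : 0 < r) (h : r < ‖z - y‖) :
    Laplacian.laplacian (radialBump y r) z = 0 := by
  have h1 : 1 < ‖z - y‖ ^ 2 / r ^ 2 := by
    rw [one_lt_div (by positivity)]
    gcongr
  rw [laplacian_radialBump, radialProfile_of_one_le h1.le, deriv_radialProfile_of_one_lt h1]
  simp

/-- The right side keeps `z - 0` and `1 ^ 2` so that it matches the unit kernel and unit test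
function literally. -/
theorem integral_comp_sq_div (h : ℝ → ℝ) (y : Euc d) {r : ℝ} (hr : 0 < r) :
    ∫ z : Euc d, h (‖z - y‖ ^ 2 / r ^ 2) = r ^ d * ∫ z : Euc d, h (‖z - 0‖ ^ 2 / 1 ^ 2) := by
  rw [integral_sub_right_eq_self (fun z : Euc d => h (‖z‖ ^ 2 / r ^ 2)) y]
  have := Measure.integral_comp_inv_smul_of_nonneg (volume : Measure (Euc d))
    (fun z : Euc d => h (‖z‖ ^ 2)) hr.le
  simp only [finrank_euclideanSpace_fin, smul_eq_mul] at this
  simp only [sub_zero, one_pow, div_one]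
  rw [← this]
  congr 1
  ext z
  rw [norm_smul, norm_inv, Real.norm_of_nonneg hr.le, mul_pow, inv_pow, inv_mul_eq_div]

/-- The mass of the unit radial test function. -/
noncomputable def bumpMass (d : ℕ) : ℝ := ∫ z : Euc d, radialBump 0 1 z

/-- The mass of the unit radial averaging kernel. -/
noncomputable def kernelMass (d : ℕ) : ℝ := ∫ z : Euc d, radialKernel 0 1 z

theorem integral_radialBump (y : Euc d) {r : ℝ} (hr : 0 < r) :
    ∫ z, radialBump y r z = r ^ d * bumpMass d :=
  integral_comp_sq_div (fun s => radialPrimitive s / 2) y hr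

theorem integral_radialKernel (y : Euc d) {r : ℝ} (hr : 0 < r) :
    ∫ z, radialKernel y r z = kernelMass d := by
  simp only [radialKernel, kernelMass, integral_const_mul]
  rw [integral_comp_sq_div radialProfile y hr]
  have : r ^ d ≠ 0 := by positivity
  field_simp
  simp

theorem bumpMass_pos (d : ℕ) : 0 < bumpMass d :=
  (contDiff_radialBump 0 1).continuous.integral_pos_of_hasCompactSupport_nonneg_nonzero
    (hasCompactSupport_radialBump 0 one_pos) (radialBump_nonneg 0 1) (x := 0)
    (by simpa [radialBump] using radialPrimitive_zero_pos.ne')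

/-- This identity is why the kernel is paired with the bump: changing the radius of a mean amounts
to testing against the Laplacian of a nonnegative test function. -/
theorem hasDerivAt_radialKernel (y z : Euc d) {r : ℝ} (hr : 0 < r) :
    HasDerivAt (fun r => radialKernel y r z)
      (r * (r ^ d)⁻¹ * Laplacian.laplacian (radialBump y r) z) r := by
  have h1 : HasDerivAt (fun r : ℝ => (r ^ d)⁻¹) (-(d * (r ^ d)⁻¹ / r)) r := by
    refine ((hasDerivAt_pow d r).inv (by positivity)).congr_deriv ?_
    rcases d with _ | n
    · simp
    · simp only [Nat.add_sub_cancel]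
      field_simp
      ring
  have h2 : HasDerivAt (fun r : ℝ => ‖z - y‖ ^ 2 / r ^ 2) (-(2 * (‖z - y‖ ^ 2 / r ^ 2) / r)) r := by
    have := ((hasDerivAt_pow 2 r).inv (by positivity)).const_mul (‖z - y‖ ^ 2)
    refine this.congr_deriv ?_
    field_simp
    ring
  refine (h1.mul ((hasDerivAt_radialProfile _).comp r h2)).congr_deriv ?_
  rw [laplacian_radialBump]
  simp only [Function.comp]
  have : r ^ d ≠ 0 := by positivity
  field_simp
  ring

theorem hasDerivAt_integral_radialKernel {g : Euc d → ℝ} {y : Euc d} {r R : ℝ}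
    (hr : 0 < r) (hrR : r < R) (hg : IntegrableOn g (Metric.closedBall y R)) :
    HasDerivAt (fun r => ∫ z, g z * radialKernel y r z)
      (r * (r ^ d)⁻¹ * ∫ z, g z * Laplacian.laplacian (radialBump y r) z) r := by
  set B := Metric.closedBall y R
  have hout : ∀ z, z ∉ B → R < ‖z - y‖ := fun z hz => by
    simpa [B, dist_eq_norm] using hz
  have hs : Set.Ioo (r / 2) R ∈ 𝓝 r := Ioo_mem_nhds (by linarith) hrR
  have hcont : ContinuousOn (fun p : ℝ × Euc d =>
      p.1 * (p.1 ^ d)⁻¹ * Laplacian.laplacian (radialBump y p.1) p.2)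
      (Set.Icc (r / 2) R ×ˢ B) := by
    have hne : ∀ p ∈ Set.Icc (r / 2) R ×ˢ B, p.1 ≠ 0 := fun p hp => by
      have : r / 2 ≤ p.1 := hp.1.1
      exact (by linarith : 0 < p.1).ne'
    have hq : ContinuousOn (fun p : ℝ × Euc d => ‖p.2 - y‖ ^ 2 / p.1 ^ 2)
        (Set.Icc (r / 2) R ×ˢ B) :=
      ContinuousOn.div (by fun_prop) (by fun_prop) fun p hp => pow_ne_zero _ (hne p hp)
    have h1 := continuous_radialProfile.comp_continuousOn hq
    have h2 := continuous_deriv_radialProfile.comp_continuousOn hq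
    simp only [laplacian_radialBump]
    have h3 : ContinuousOn (fun p : ℝ × Euc d => p.1 ^ 2) (Set.Icc (r / 2) R ×ˢ B) := by fun_prop
    have h4 : ∀ p ∈ Set.Icc (r / 2) R ×ˢ B, p.1 ^ 2 ≠ 0 := fun p hp => pow_ne_zero _ (hne p hp)
    refine ContinuousOn.mul (ContinuousOn.mul (by fun_prop)
      (ContinuousOn.inv₀ (by fun_prop) fun p hp => pow_ne_zero _ (hne p hp))) ?_
    exact (((continuousOn_const.mul h1).div h3 h4).add
      (((continuousOn_const.mul hq).mul h2).div h3 h4)).neg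
  -- Radii at least `r / 2` stay away from the singularity at 0, so the radial derivative of the
  -- kernel is bounded by compactness; `‖g‖ * C` dominates.
  obtain ⟨C, hC⟩ := (isCompact_Icc.prod (isCompact_closedBall y R)).exists_bound_of_continuousOn
    hcont
  have hfix : ∀ t, Continuous fun z => t * (t ^ d)⁻¹ * Laplacian.laplacian (radialBump y t) z := by
    intro t
    have hq : Continuous fun z : Euc d => ‖z - y‖ ^ 2 / t ^ 2 := by fun_prop
    have h1 := continuous_radialProfile.comp hq
    have h2 := continuous_deriv_radialProfile.comp hq
    simp only [laplacian_radialBump]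
    exact continuous_const.mul (((continuous_const.mul h1).div_const _).add
      (((continuous_const.mul hq).mul h2).div_const _)).neg
  have hkint : ∀ t, IntegrableOn (fun z => g z * radialKernel y t z) B := fun t =>
    hg.mul_continuousOn (continuous_radialKernel y t).continuousOn (isCompact_closedBall y R)
  have key := (hasDerivAt_integral_of_dominated_loc_of_deriv_le (μ := volume.restrict B) (𝕜 := ℝ)
    (F := fun t z => g z * radialKernel y t z)
    (F' := fun t z => g z * (t * (t ^ d)⁻¹ * Laplacian.laplacian (radialBump y t) z))
    (bound := fun z => ‖g z‖ * C) hs (Eventually.of_forall fun t => (hkint t).aestronglyMeasurable)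
    (hkint r) (hg.aestronglyMeasurable.mul (hfix r).aestronglyMeasurable)
    (by
      filter_upwards [ae_restrict_mem Metric.isClosed_closedBall.measurableSet] with z hz t ht
      rw [norm_mul]
      gcongr
      exact hC (t, z) ⟨Set.Ioo_subset_Icc_self ht, hz⟩)
    (hg.norm.mul_const C)
    (Eventually.of_forall fun z t ht =>
      (hasDerivAt_radialKernel y z (by linarith [ht.1])).const_mul _)).2
  have e1 : ∫ z in B, g z * (r * (r ^ d)⁻¹ * Laplacian.laplacian (radialBump y r) z)
      = r * (r ^ d)⁻¹ * ∫ z, g z * Laplacian.laplacian (radialBump y r) z := by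
    rw [setIntegral_eq_integral_of_forall_compl_eq_zero, ← integral_const_mul]
    · congr 1
      ext z
      ring
    · intro z hz
      rw [laplacian_radialBump_eq_zero hr (hrR.trans (hout z hz))]
      simp
  rw [e1] at key
  refine key.congr_of_eventuallyEq ?_
  filter_upwards [hs] with t ht
  rw [setIntegral_eq_integral_of_forall_compl_eq_zero]
  intro z hz
  rw [radialKernel_eq_zero (by linarith [ht.1]) (ht.2.trans (hout z hz)).le, mul_zero]

/-- Monotonicity of the radial means of a function with Laplacian bounded above. -/
theorem DistribLaplacianLE.radial_mean_le {X : Set (Euc d)} {φ : Euc d → EReal} {c : ℝ}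
    (hφ : DistribLaplacianLE X φ c) {y : Euc d} {R s r : ℝ}
    (hR : Metric.closedBall y R ⊆ X) (hs : 0 < s) (hsr : s ≤ r) (hrR : r < R) :
    ∫ z, (φ z).toReal * radialKernel y r z ≤
      (∫ z, (φ z).toReal * radialKernel y s z) + c * bumpMass d * (r ^ 2 - s ^ 2) / 2 := by
  have hg : IntegrableOn (fun z => (φ z).toReal) (Metric.closedBall y R) :=
    hφ.2.1.integrableOn_compact_subset hR (isCompact_closedBall y R)
  have hd : ∀ t ∈ Set.Ioo 0 R, HasDerivAt (fun t => (∫ z, (φ z).toReal * radialKernel y t z)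
      - c * bumpMass d / 2 * t ^ 2)
      (t * (t ^ d)⁻¹ * (∫ z, (φ z).toReal * Laplacian.laplacian (radialBump y t) z)
        - c * bumpMass d / 2 * (2 * t)) t := fun t ht =>
    (hasDerivAt_integral_radialKernel ht.1 ht.2 hg).sub
      (((hasDerivAt_pow 2 t).congr_deriv (by simp)).const_mul _)
  have hanti : AntitoneOn (fun t => (∫ z, (φ z).toReal * radialKernel y t z)
      - c * bumpMass d / 2 * t ^ 2) (Set.Ioo 0 R) := by
    refine antitoneOn_of_deriv_nonpos (convex_Ioo 0 R)
      (fun t ht => (hd t ht).continuousAt.continuousWithinAt)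
      (fun t ht => (hd t (interior_subset ht)).differentiableAt.differentiableWithinAt)
      fun t ht => ?_
    have ht := interior_subset ht
    have ht0 : 0 < t := ht.1
    rw [(hd t ht).deriv]
    have h1 := hφ.2.2 (radialBump y t) (contDiff_radialBump y t)
      (hasCompactSupport_radialBump y ht.1)
      ((tsupport_radialBump_subset y ht.1).trans
        ((Metric.closedBall_subset_closedBall ht.2.le).trans hR)) (radialBump_nonneg y t)
    rw [integral_radialBump y ht.1] at h1
    have h2 : t * (t ^ d)⁻¹ * (∫ z, (φ z).toReal * Laplacian.laplacian (radialBump y t) z)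
        ≤ t * (t ^ d)⁻¹ * (c * (t ^ d * bumpMass d)) := by gcongr
    have h3 : t * (t ^ d)⁻¹ * (c * (t ^ d * bumpMass d)) = c * bumpMass d / 2 * (2 * t) := by
      have : t ^ d ≠ 0 := by positivity
      field_simp
    linarith
  have := hanti ⟨hs, hsr.trans_lt hrR⟩ ⟨hs.trans_le hsr, hrR⟩ hsr
  simp only at this
  linarith

end RadialIntegrals

/-! ### The mean value inequality and second moments. -/

section RadialMeans

variable {d : ℕ}

theorem exists_superlevel_radialProfile {t : ℝ} (ht : 0 ≤ t) :
    ∃ σ ∈ Set.Icc (0 : ℝ) 1, ∀ s, 0 ≤ s → (t < radialProfile s ↔ s < σ) := by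
  set S := {s ∈ Set.Icc (0 : ℝ) 1 | radialProfile s ≤ t}
  have hS : IsCompact S := isCompact_Icc.inter_right
    (isClosed_le continuous_radialProfile continuous_const)
  have hne : S.Nonempty := ⟨1, by simp, by simpa [radialProfile_of_one_le] using ht⟩
  have hmem := hS.sInf_mem hne
  refine ⟨sInf S, hmem.1, fun s hs => ⟨fun h => ?_, fun h => ?_⟩⟩
  · by_contra! h'
    exact absurd ((antitone_radialProfile h').trans hmem.2) (not_le.2 h)
  · by_contra! h'
    exact absurd (csInf_le hS.bddBelow ⟨⟨hs, h.le.trans hmem.1.2⟩, h'⟩) (not_le.2 h)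

theorem superlevel_radialProfile_eq_ball (y : Euc d) {r t : ℝ} (hr : 0 < r) (ht : 0 ≤ t) :
    ∃ ρ ∈ Set.Icc 0 r, {z | t < radialProfile (‖z - y‖ ^ 2 / r ^ 2)} = Metric.ball y ρ := by
  obtain ⟨σ, hσ, h⟩ := exists_superlevel_radialProfile ht
  refine ⟨r * √σ, ⟨by positivity, ?_⟩, ?_⟩
  · exact mul_le_of_le_one_right hr.le (Real.sqrt_le_one.2 hσ.2)
  · ext z
    rw [Set.mem_ofPred_eq, h _ (by positivity), Metric.mem_ball, dist_eq_norm,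
      div_lt_iff₀ (by positivity), ← Real.lt_sqrt (norm_nonneg _), Real.sqrt_mul hσ.1,
      Real.sqrt_sq hr.le, mul_comm]

/-- Layer cake: the superlevel sets of the kernel are balls centred at `y`, so the kernel is a
positive superposition of ball indicators. This transfers the normalization from ball averages to
smooth means. -/
theorem integral_mul_radialKernel_nonpos {g : Euc d → ℝ} {y : Euc d} {r : ℝ} (hr : 0 < r)
    (hg : IntegrableOn g (Metric.ball y r))
    (h : ∀ ρ ∈ Set.Ioc 0 r, ∫ z in Metric.ball y ρ, g z ≤ 0) :
    ∫ z, g z * radialKernel y r z ≤ 0 := by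
  set p : Euc d → ℝ := fun z => radialProfile (‖z - y‖ ^ 2 / r ^ 2)
  have hp : Continuous p := continuous_radialProfile.comp (by fun_prop)
  set T := {q : Euc d × ℝ | q.2 < p q.1}
  have hT : MeasurableSet T := (isOpen_lt continuous_snd (hp.comp continuous_fst)).measurableSet
  have hint : Integrable
      (Function.uncurry fun (z : Euc d) (t : ℝ) => T.indicator (fun q => g q.1) (z, t))
      ((volume.restrict (Metric.ball y r)).prod (volume.restrict (Set.Ioc (0 : ℝ) 1))) :=
    (Integrable.comp_fst hg _).indicator hT
  have h1 : ∫ z, g z * p z = ∫ z in Metric.ball y r, ∫ t in Set.Ioc (0 : ℝ) 1,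
      T.indicator (fun q => g q.1) (z, t) := by
    rw [← setIntegral_eq_integral_of_forall_compl_eq_zero (s := Metric.ball y r)]
    · congr 1
      ext z
      change g z * p z = ∫ t in Set.Ioc (0 : ℝ) 1, (Set.Iio (p z)).indicator (fun _ => g z) t
      rw [setIntegral_indicator measurableSet_Iio, setIntegral_const, smul_eq_mul, mul_comm]
      congr 1
      have h2 : Set.Ioc 0 1 ∩ Set.Iio (p z) = Set.Ioo 0 (p z) := by
        ext t
        simp only [Set.mem_Ioo, Set.mem_inter_iff, Set.mem_Ioc, Set.mem_Iio]
        have := radialProfile_le_one (‖z - y‖ ^ 2 / r ^ 2)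
        exact ⟨fun h => ⟨h.1.1, h.2⟩, fun h => ⟨⟨h.1, h.2.le.trans this⟩, h.2⟩⟩
      rw [h2, Real.volume_real_Ioo_of_le (radialProfile_nonneg _), sub_zero]
    · intro z hz
      rw [Metric.mem_ball, dist_eq_norm, not_lt] at hz
      simp [p, radialProfile_of_one_le (one_le_sq_div_sq hr hz)]
  have h2 : ∫ z, g z * p z ≤ 0 := by
    rw [h1, integral_integral_swap hint]
    refine setIntegral_nonpos measurableSet_Ioc fun t ht => ?_
    obtain ⟨ρ, hρ, hball⟩ := superlevel_radialProfile_eq_ball y hr ht.1.le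
    have : ∀ z, T.indicator (fun q => g q.1) (z, t) = (Metric.ball y ρ).indicator g z := by
      intro z
      rw [← hball]
      rfl
    simp only [this]
    rw [setIntegral_indicator Metric.isOpen_ball.measurableSet,
      Set.inter_eq_right.2 (Metric.ball_subset_ball hρ.2)]
    rcases hρ.1.eq_or_lt with h0 | h0
    · simp [← h0]
    · exact h ρ ⟨h0, hρ.2⟩
  have h3 : ∫ z, g z * radialKernel y r z = (r ^ d)⁻¹ * ∫ z, g z * p z := by
    rw [← integral_const_mul]
    congr 1
    ext z
    simp only [radialKernel, p]
    ring
  rw [h3]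
  exact mul_nonpos_of_nonneg_of_nonpos (by positivity) h2

theorem kernelMass_nonneg (d : ℕ) : 0 ≤ kernelMass d :=
  integral_nonneg (radialKernel_nonneg 0 one_pos)

theorem integrable_radialKernel (y : Euc d) {r : ℝ} (hr : 0 < r) :
    Integrable (radialKernel y r) :=
  (continuous_radialKernel y r).integrable_of_hasCompactSupport (hasCompactSupport_radialKernel y hr)

theorem integrable_mul_radialKernel {g : Euc d → ℝ} {y : Euc d} {r : ℝ} (hr : 0 < r)
    (hg : IntegrableOn g (Metric.closedBall y r)) :
    Integrable (fun z => g z * radialKernel y r z) := by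
  have : IntegrableOn (fun z => g z * radialKernel y r z) (Metric.closedBall y r) :=
    hg.mul_continuousOn (continuous_radialKernel y r).continuousOn (isCompact_closedBall y r)
  refine (integrableOn_iff_integrable_of_support_subset fun z hz => ?_).1 this
  by_contra h
  rw [Metric.mem_closedBall, dist_eq_norm, not_le] at h
  exact hz (by simp [radialKernel_eq_zero hr h.le])

/-- The radial means at small radii are bounded by the value at the centre. -/
theorem AboveMeans.eventually_radial_mean_le {X : Set (Euc d)} {φ : Euc d → EReal}
    (hφ : AboveMeans X φ) {y : Euc d} (hy : y ∈ X) {R b : ℝ} (hR : 0 < R)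
    (hint : IntegrableOn (fun z => (φ z).toReal) (Metric.closedBall y R))
    (hb : φ y < b) :
    ∃ s₀ > 0, ∀ s, 0 < s → s < s₀ →
      ∫ z, (φ z).toReal * radialKernel y s z ≤ b * kernelMass d := by
  have h1 := eventually_lt_of_limsup_lt ((hφ y hy).trans_lt hb)
  obtain ⟨s₀, hs₀, h2⟩ := mem_nhdsGT_iff_exists_Ioo_subset.1 h1
  have hs₀ : 0 < s₀ := hs₀
  refine ⟨min s₀ R, lt_min hs₀ hR, fun s hs hss => ?_⟩
  have hsR := hss.trans_le (min_le_right _ _)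
  have hballint : ∀ ρ ≤ R, IntegrableOn (fun z => (φ z).toReal) (Metric.ball y ρ) := fun ρ hρ =>
    hint.mono_set (Metric.ball_subset_closedBall.trans (Metric.closedBall_subset_closedBall hρ))
  have hconst : ∀ ρ, IntegrableOn (fun _ : Euc d => b) (Metric.ball y ρ) := fun ρ =>
    integrableOn_const measure_ball_lt_top.ne
  have h3 := integral_mul_radialKernel_nonpos (g := fun z => (φ z).toReal - b) (y := y) hs
    ((hballint s hsR.le).sub (hconst s)) (fun ρ hρ => by
      have h4 : ((⨍ z in Metric.ball y ρ, (φ z).toReal : ℝ) : EReal) < b :=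
        h2 ⟨hρ.1, hρ.2.trans_lt (hss.trans_le (min_le_left _ _))⟩
      have h5 : ⨍ z in Metric.ball y ρ, (φ z).toReal < b := by exact_mod_cast h4
      rw [integral_sub (hballint ρ (hρ.2.trans hsR.le)) (hconst ρ), setIntegral_const]
      have h6 : 0 < volume.real (Metric.ball y ρ) :=
        ENNReal.toReal_pos (Metric.measure_ball_pos volume y hρ.1).ne' measure_ball_lt_top.ne
      rw [setAverage_eq, smul_eq_mul, inv_mul_lt_iff₀ h6] at h5
      rw [smul_eq_mul]
      linarith)
  simp only [sub_mul] at h3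
  rw [integral_sub (integrable_mul_radialKernel hs (hint.mono_set
    (Metric.closedBall_subset_closedBall hsR.le))) ((integrable_radialKernel y hs).const_mul b),
    integral_const_mul, integral_radialKernel y hs] at h3
  linarith

/-- The mean value inequality for a normalized function with Laplacian bounded above. -/
theorem DistribLaplacianLE.radial_mean_le_value {X : Set (Euc d)} {φ : Euc d → EReal} {c : ℝ}
    (hφ : DistribLaplacianLE X φ c) (hm : AboveMeans X φ) (hc : 0 ≤ c) {y : Euc d} {R r : ℝ}
    (hR : Metric.closedBall y R ⊆ X) (hr : 0 < r) (hrR : r < R) (ht : φ y ≠ ⊤) (hb : φ y ≠ ⊥) :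
    ∫ z, (φ z).toReal * radialKernel y r z ≤
      (φ y).toReal * kernelMass d + c * bumpMass d * r ^ 2 / 2 := by
  have hK := kernelMass_nonneg d
  refine le_of_forall_pos_le_add fun ε hε => ?_
  have hlt : φ y < (((φ y).toReal + ε / (kernelMass d + 1) : ℝ) : EReal) := by
    conv_lhs => rw [← EReal.coe_toReal ht hb]
    have : 0 < ε / (kernelMass d + 1) := by positivity
    exact_mod_cast lt_add_of_pos_right _ this
  obtain ⟨s₀, hs₀, h⟩ := hm.eventually_radial_mean_le
    (hR (Metric.mem_closedBall_self (hr.trans hrR).le)) (hr.trans hrR)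
    (hφ.2.1.integrableOn_compact_subset hR (isCompact_closedBall y R)) hlt
  set s := min (s₀ / 2) r
  have hs : 0 < s := by positivity
  have h1 := h s hs ((min_le_left _ _).trans_lt (by linarith))
  have h2 := hφ.radial_mean_le hR hs (min_le_right _ _) hrR
  have h3 : ε / (kernelMass d + 1) * kernelMass d ≤ ε := by
    rw [div_mul_eq_mul_div, div_le_iff₀ (by positivity)]
    nlinarith
  have h4 : 0 ≤ c * bumpMass d * s ^ 2 / 2 := by
    have := bumpMass_pos d
    positivity
  nlinarith

/-- The second moments of the radial kernel. -/
theorem integral_inner_mul_radialKernel (a y : Euc d) (C : Euc d →L[ℝ] Euc d) {r : ℝ}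
    (hr : 0 < r) :
    ∫ z, inner ℝ (a + C (z - y)) (z - y) * radialKernel y r z =
      r ^ 2 * (LinearMap.trace ℝ (Euc d) (C : Euc d →ₗ[ℝ] Euc d) * bumpMass d) := by
  have b : OrthonormalBasis (Fin d) ℝ (Euc d) := EuclideanSpace.basisFun (Fin d) ℝ
  have hW := contDiff_radialBump y r
  have hWc := hasCompactSupport_radialBump y hr
  have hfd : ∀ i, Continuous fun z => fderiv ℝ (radialBump y r) z (b i) := fun i =>
    (hW.continuous_fderiv (by simp)).clm_apply continuous_const
  have hfdc : ∀ i, HasCompactSupport fun z => fderiv ℝ (radialBump y r) z (b i) := fun i =>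
    hWc.fderiv_apply (𝕜 := ℝ) (b i)
  have hder : ∀ i z, HasFDerivAt (fun z => inner ℝ (b i) (a + C (z - y)))
      (innerSL ℝ (b i) ∘L C) z := fun i z => by
    have h1 : HasFDerivAt (fun z => a + C (z - y)) C z := by
      simp only [map_sub]
      exact ((C.hasFDerivAt (x := z)).sub_const (C y)).const_add a
    exact (innerSL ℝ (b i)).hasFDerivAt.comp z h1
  have hcont : ∀ i, Continuous fun z => inner ℝ (b i) (a + C (z - y)) := fun i => by fun_prop
  have hint : ∀ i, Integrable fun z =>
      inner ℝ (b i) (a + C (z - y)) * fderiv ℝ (radialBump y r) z (b i) := fun i =>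
    ((hcont i).mul (hfd i)).integrable_of_hasCompactSupport (hfdc i).mul_left
  -- `(z - y)` times the kernel is a multiple of the gradient of the bump. Integration by parts
  -- therefore produces the same constant `bumpMass` as the mean value inequality, and no moment has
  -- to be computed.
  have hibp : ∀ i, ∫ z, inner ℝ (b i) (a + C (z - y)) * fderiv ℝ (radialBump y r) z (b i)
      = - (inner ℝ (b i) (C (b i)) * (r ^ d * bumpMass d)) := by
    intro i
    rw [integral_mul_fderiv_eq_neg_fderiv_mul_of_integrable]
    · simp only [(hder i _).fderiv]
      rw [← integral_radialBump y hr, ← integral_const_mul]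
      simp
    · simp only [(hder i _).fderiv]
      exact (hW.continuous.integrable_of_hasCompactSupport hWc).const_mul _
    · exact hint i
    · exact ((hcont i).mul hW.continuous).integrable_of_hasCompactSupport hWc.mul_left
    · exact fun z _ => (hder i z).differentiableAt
    · exact fun z _ => hW.differentiable (by simp) z
  have hpt : ∀ z, inner ℝ (a + C (z - y)) (z - y) * radialKernel y r z
      = -(r ^ 2 * (r ^ d)⁻¹) *
        ∑ i, inner ℝ (b i) (a + C (z - y)) * fderiv ℝ (radialBump y r) z (b i) := by
    intro z
    rw [(hasFDerivAt_radialBump y z r).fderiv, ← b.sum_inner_mul_inner (a + C (z - y)) (z - y),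
      Finset.sum_mul, Finset.mul_sum]
    refine Finset.sum_congr rfl fun i _ => ?_
    rw [smul_apply, innerSL_apply_apply, radialKernel, smul_eq_mul,
      real_inner_comm (b i), real_inner_comm (b i) (z - y)]
    field_simp
  simp only [hpt]
  rw [integral_const_mul, integral_finsetSum _ fun i _ => hint i,
    Finset.sum_congr rfl fun i _ => hibp i, Finset.sum_neg_distrib, ← Finset.sum_mul,
    LinearMap.trace_eq_sum_inner _ b]
  have : r ^ d ≠ 0 := by positivity
  simp only [ContinuousLinearMap.coe_coe]
  field_simp

end RadialMeans

/-! ### From a trace bound on the inverse to a determinant bound. -/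

section HessianDeterminant

/-- The arithmetic-geometric inequality in the form needed: multiply `λ ≤ exp (λ - 1)` over the
nonnegative eigenvalues. -/
theorem LinearMap.IsPositive.det_le_exp {E : Type*} [NormedAddCommGroup E] [InnerProductSpace ℝ E]
    [FiniteDimensional ℝ E] {T : E →ₗ[ℝ] E} (hT : T.IsPositive) :
    T.det ≤ Real.exp (LinearMap.trace ℝ E T - Module.finrank ℝ E) := by
  have hdet := hT.1.det_eq_prod_eigenvalues rfl
  have htr := hT.1.trace_eq_sum_eigenvalues rfl
  simp only [RCLike.ofReal_real_eq_id] at hdet htr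
  rw [hdet, htr]
  calc ∏ i, hT.1.eigenvalues rfl i ≤ ∏ i, Real.exp (hT.1.eigenvalues rfl i - 1) := by
        refine Finset.prod_le_prod (fun i _ => hT.nonneg_eigenvalues rfl i) fun i _ => ?_
        linarith [Real.add_one_le_exp (hT.1.eigenvalues rfl i - 1)]
    _ = _ := by
        rw [← Real.exp_sum, Finset.sum_sub_distrib]
        simp

variable {E : Type*} [NormedAddCommGroup E] [InnerProductSpace ℝ E]

/-- The Hessian of a convex function is positive semidefinite. -/
theorem ConvexOn.inner_hessian_nonneg [CompleteSpace E] {D : Set E} {f : E → ℝ}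
    (hf : ConvexOn ℝ D f) {x : E} (hx : D ∈ 𝓝 x) (hd : DifferentiableAt ℝ f x) {A : E →L[ℝ] E}
    (hA : (fun h => f (x + h) - f x - inner ℝ (gradient f x) h - (1 / 2) * inner ℝ (A h) h)
      =o[𝓝 0] (fun h => ‖h‖ ^ 2)) (v : E) : 0 ≤ inner ℝ (A v) v := by
  by_contra! hneg
  have hv : v ≠ 0 := by
    rintro rfl
    simp at hneg
  have hv0 : 0 < ‖v‖ ^ 2 := by positivity
  have h1 := hA.def (show 0 < -inner ℝ (A v) v / (4 * ‖v‖ ^ 2) from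
    div_pos (neg_pos.2 hneg) (by positivity))
  have hxv : Tendsto (fun h : E => x + h) (𝓝 0) (𝓝 x) := by
    simpa using (continuous_const_add x).tendsto 0
  have htv : Tendsto (fun t : ℝ => t • v) (𝓝[>] 0) (𝓝 0) := by
    have : Tendsto (fun t : ℝ => t • v) (𝓝 0) (𝓝 (0 : E)) := by
      have hc : Continuous fun t : ℝ => t • v := by fun_prop
      simpa using hc.tendsto 0
    exact this.mono_left nhdsWithin_le_nhds
  obtain ⟨t, ⟨h2, h3⟩, ht⟩ := ((htv.eventually (h1.and (hxv hx))).and self_mem_nhdsWithin).exists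
  have ht : 0 < t := ht
  have h4 := hf.add_inner_gradient_le (mem_of_mem_nhds hx) h3 hd
  have h5 := (abs_le.1 h2).2
  rw [norm_pow, norm_norm, norm_smul, Real.norm_of_nonneg ht.le, map_smul, inner_smul_left,
    inner_smul_right] at h5
  rw [add_sub_cancel_left] at h4
  have h6 : -inner ℝ (A v) v / (4 * ‖v‖ ^ 2) * (t * ‖v‖) ^ 2 = -inner ℝ (A v) v / 4 * t ^ 2 := by
    field_simp
  rw [h6] at h5
  simp only [conj_trivial] at h5
  have h7 : t ^ 2 * inner ℝ (A v) v < 0 := mul_neg_of_pos_of_neg (by positivity) hneg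
  simp only [inner_smul_right] at h4 h5
  nlinarith

/-- A positive semidefinite perturbation of a multiple of the identity is invertible with
positive inverse. -/
theorem exists_inverse_add_smul_id [FiniteDimensional ℝ E] {A : E →L[ℝ] E}
    (hA : (A : E →ₗ[ℝ] E).IsSymmetric) (hpos : ∀ v, 0 ≤ inner ℝ (A v) v) {ε : ℝ} (hε : 0 < ε) :
    ∃ C : E →L[ℝ] E, (∀ w, (A + ε • ContinuousLinearMap.id ℝ E) (C w) = w) ∧
      (C : E →ₗ[ℝ] E).IsPositive ∧ (A + ε • ContinuousLinearMap.id ℝ E).det * C.det = 1 := by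
  set B := A + ε • ContinuousLinearMap.id ℝ E
  have hB : ∀ v, B v = A v + ε • v := fun v => rfl
  have hinj : Function.Injective (B : E →ₗ[ℝ] E) := by
    rw [injective_iff_map_eq_zero]
    intro v hv
    have h1 : inner ℝ (B v) v = 0 := by
      rw [show B v = 0 from hv, inner_zero_left]
    rw [hB, inner_add_left, inner_smul_left, real_inner_self_eq_norm_sq] at h1
    simp only [conj_trivial] at h1
    have h2 : ‖v‖ ^ 2 = 0 := by
      have := hpos v
      have h3 : 0 ≤ ‖v‖ ^ 2 := by positivity
      nlinarith
    simpa using h2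
  set e := LinearEquiv.ofInjectiveEndo (B : E →ₗ[ℝ] E) hinj
  have he : ∀ w, B (e.symm w) = w := fun w => e.apply_symm_apply w
  have hBsym : ∀ v w, inner ℝ (B v) w = inner ℝ v (B w) := by
    intro v w
    have := hA v w
    simp only [ContinuousLinearMap.coe_coe] at this
    simp [hB, inner_add_left, inner_add_right, inner_smul_left, inner_smul_right, this]
  refine ⟨LinearMap.toContinuousLinearMap (e.symm : E →ₗ[ℝ] E), he, ⟨fun v w => ?_, fun v => ?_⟩,
    ?_⟩
  · change inner ℝ (e.symm v) w = inner ℝ v (e.symm w)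
    conv_lhs => rw [← he w]
    rw [← hBsym, he]
  · change 0 ≤ inner ℝ (e.symm v) v
    obtain ⟨w, hw⟩ : ∃ w, w = e.symm v := ⟨_, rfl⟩
    have hv : v = B w := by rw [hw, he]
    rw [← hw, hv, hB, inner_add_right, inner_smul_right, real_inner_self_eq_norm_sq, real_inner_comm]
    have := hpos w
    positivity
  · have h1 : (B : E →ₗ[ℝ] E) ∘ₗ (e.symm : E →ₗ[ℝ] E) = LinearMap.id := LinearMap.ext he
    have h2 := congrArg LinearMap.det h1
    rw [LinearMap.det_comp, LinearMap.det_id] at h2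
    exact h2

/-- `A` is not known to be invertible, so the trace bound is used for `A + ε` and the determinant
passes to the limit. -/
theorem one_le_det_of_trace_inverse_le [FiniteDimensional ℝ E] {A : E →L[ℝ] E}
    (hA : (A : E →ₗ[ℝ] E).IsSymmetric) (hpos : ∀ v, 0 ≤ inner ℝ (A v) v)
    (h : ∀ ε : ℝ, 0 < ε → ∀ C : E →L[ℝ] E, (C : E →ₗ[ℝ] E).IsPositive →
      (∀ w, (A + ε • ContinuousLinearMap.id ℝ E) (C w) = w) →
      LinearMap.trace ℝ E (C : E →ₗ[ℝ] E) ≤ Module.finrank ℝ E) : 1 ≤ A.det := by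
  have key : ∀ ε : ℝ, 0 < ε → 1 ≤ (A + ε • ContinuousLinearMap.id ℝ E).det := by
    intro ε hε
    obtain ⟨C, hC1, hC2, hC3⟩ := exists_inverse_add_smul_id hA hpos hε
    have h1 := h ε hε C hC2 hC1
    have h2 : C.det ≤ 1 := hC2.det_le_exp.trans (Real.exp_le_one_iff.2 (by linarith))
    have h3 : 0 ≤ C.det := by
      change 0 ≤ LinearMap.det (C : E →ₗ[ℝ] E)
      have hdet := hC2.1.det_eq_prod_eigenvalues rfl
      simp only [RCLike.ofReal_real_eq_id, id] at hdet
      rw [hdet]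
      exact Finset.prod_nonneg fun i _ => hC2.nonneg_eigenvalues rfl i
    by_contra! h4
    rcases h3.eq_or_lt with h5 | h5
    · simp [← h5] at hC3
    · linarith [mul_lt_of_lt_one_left h5 h4]
  have hcont : Continuous fun ε : ℝ => (A + ε • ContinuousLinearMap.id ℝ E).det :=
    ContinuousLinearMap.continuous_det.comp (by fun_prop)
  have hlim : Tendsto (fun ε : ℝ => (A + ε • ContinuousLinearMap.id ℝ E).det) (𝓝[>] 0)
      (𝓝 A.det) := by
    have := hcont.tendsto 0
    simp only [zero_smul, add_zero] at this
    exact this.mono_left nhdsWithin_le_nhds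
  exact ge_of_tendsto hlim (by filter_upwards [self_mem_nhdsWithin] with ε hε using key ε hε)

end HessianDeterminant

/-! ### The determinant bound at a point with a Hessian. -/

section PointwiseDeterminant

variable {d : ℕ}

/-- Near-maximizers in the Legendre transform at a point of differentiability converge to the
gradient. -/
theorem exists_near_maximizer {φ : Euc d → EReal} (hb : ∀ y, φ y ≠ ⊥) (hp : IsProper (legendre φ))
    (hc : IsConvexFn (legendre φ)) {x : Euc d} (hx : x ∈ interior {x | legendre φ x ≠ ⊤})
    (hd : DifferentiableAt ℝ (finPart (legendre φ)) x) {R η : ℝ} (hR : 0 < R) (hη : 0 < η) :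
    ∃ y, φ y ≠ ⊤ ∧ ‖y - gradMap (legendre φ) x‖ ≤ R ∧
      finPart (legendre φ) x - η < inner ℝ x y - (φ y).toReal := by
  obtain ⟨δ, hδ, h⟩ := approx_subgradient_near_gradient (hc.convexOn_finPart hp)
    (mem_interior_iff_mem_nhds.1 hx) hd hR
  obtain ⟨y, hy, hlt⟩ := exists_legendre_sub_lt hp (interior_subset hx) hb (lt_min hδ hη)
  refine ⟨y, hy, h x (interior_subset hx) (by simpa using hδ.le) y (min δ η) (min_le_left _ _)
    fun w hw => ?_, by linarith [min_le_right δ η]⟩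
  have := inner_sub_le_legendre hp hw (hb y) hy
  rw [inner_sub_right, real_inner_comm w y, real_inner_comm x y]
  linarith

/-- A second-order expansion of the Legendre transform gives a quadratic lower bound. -/
theorem exists_quadratic_lower_bound {φ : Euc d → EReal} (hb : ∀ y, φ y ≠ ⊥)
    (hp : IsProper (legendre φ)) {x : Euc d} (hx : x ∈ interior {x | legendre φ x ≠ ⊤})
    {A C : Euc d →L[ℝ] Euc d} (hA : HasHessianAt (legendre φ) A x) {ε : ℝ} (hε : 0 < ε)
    (hC : ∀ w, (A + ε • ContinuousLinearMap.id ℝ (Euc d)) (C w) = w) :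
    ∃ δ > 0, ∀ z ∈ Metric.ball (gradMap (legendre φ) x) δ, φ z ≠ ⊤ →
      inner ℝ x z - finPart (legendre φ) x
        + (1 / 2) * inner ℝ (C (z - gradMap (legendre φ) x)) (z - gradMap (legendre φ) x)
      ≤ (φ z).toReal := by
  set y := gradMap (legendre φ) x
  have h1 := hA.2.2.def (half_pos hε)
  have hxv : Tendsto (fun h : Euc d => x + h) (𝓝 0) (𝓝 x) := by
    simpa using (continuous_const_add x).tendsto 0
  have hCv : Tendsto (fun z => C (z - y)) (𝓝 y) (𝓝 0) := by
    have hc : Continuous fun z => C (z - y) := by fun_prop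
    simpa using hc.tendsto y
  obtain ⟨δ, hδ, h2⟩ := Metric.eventually_nhds_iff_ball.1
    (hCv.eventually (h1.and (hxv (mem_interior_iff_mem_nhds.1 hx))))
  refine ⟨δ, hδ, fun z hz hzt => ?_⟩
  obtain ⟨h3, h4⟩ := h2 z hz
  -- This `h` maximizes `h · (z - y) - ½ (A + ε)h · h`; the term `ε` absorbs the remainder of the
  -- expansion.
  obtain ⟨h, hh⟩ : ∃ h, h = C (z - y) := ⟨_, rfl⟩
  have h5 := hC (z - y)
  rw [← hh] at h3 h4 h5 ⊢
  have h6 := (abs_le.1 h3).2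
  have h7 := inner_sub_le_legendre hp h4 (hb z) hzt
  have h8 : inner ℝ (A h) h + ε * ‖h‖ ^ 2 = inner ℝ h (z - y) := by
    rw [← h5]
    simp [inner_add_right, inner_smul_right, real_inner_comm]
  rw [norm_pow, norm_norm] at h6
  rw [inner_add_left] at h7
  rw [inner_sub_right] at h8 ⊢
  change _ - inner ℝ y h - _ ≤ _ at h6
  rw [real_inner_comm h y] at h6
  linarith

/-- Near `y = ∇ψ(x)`, `φ` lies above a quadratic with Hessian `C`, while at a near-maximizer `y'` it
exceeds `x · y' - ψ(x)` by less than `η`. Comparing radial means around `y'` gives `tr C - d ≤ O(η)`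
at a fixed radius. -/
theorem trace_inverse_hessian_le {X : Set (Euc d)} (hX : IsOpen X) {φ : Euc d → EReal}
    (hb : ∀ y, φ y ≠ ⊥) (hΔ : DistribLaplacianLE X φ d)
    (hm : AboveMeans X φ) (hp : IsProper (legendre φ)) (hc : IsConvexFn (legendre φ)) {x : Euc d}
    (hx : x ∈ interior {x | legendre φ x ≠ ⊤}) {A C : Euc d →L[ℝ] Euc d}
    (hA : HasHessianAt (legendre φ) A x) (hy : gradMap (legendre φ) x ∈ X) {ε : ℝ} (hε : 0 < ε)
    (hCpos : (C : Euc d →ₗ[ℝ] Euc d).IsPositive)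
    (hC : ∀ w, (A + ε • ContinuousLinearMap.id ℝ (Euc d)) (C w) = w) :
    LinearMap.trace ℝ (Euc d) (C : Euc d →ₗ[ℝ] Euc d) ≤ d := by
  obtain ⟨δ, hδ, hlow⟩ := exists_quadratic_lower_bound hb hp hx hA hε hC
  obtain ⟨δ', hδ', hXb⟩ := Metric.isOpen_iff.1 hX _ hy
  set y := gradMap (legendre φ) x
  set f := finPart (legendre φ) x
  set T := LinearMap.trace ℝ (Euc d) (C : Euc d →ₗ[ℝ] Euc d)
  obtain ⟨R, hR, hRδ, hRδ'⟩ : ∃ R > 0, 2 * R < δ ∧ 2 * R < δ' :=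
    ⟨min δ δ' / 4, by positivity, by linarith [min_le_left δ δ', lt_min hδ hδ'],
      by linarith [min_le_right δ δ', lt_min hδ hδ']⟩
  set r := R / 2
  have hr : 0 < r := half_pos hR
  have hI := bumpMass_pos d
  have hK := kernelMass_nonneg d
  have key : ∀ η : ℝ, 0 < η →
      r ^ 2 / 2 * bumpMass d * (T - d) ≤ η * kernelMass d := by
    intro η hη
    obtain ⟨y', hy't, hy'R, hy'⟩ := exists_near_maximizer hb hp hc hx hA.2.1 hR hη
    have hsub : ∀ z ∈ Metric.closedBall y' R, dist z y ≤ 2 * R := fun z hz => by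
      have h1 : dist z y' ≤ R := hz
      have h2 : dist y' y ≤ R := by rwa [dist_eq_norm]
      linarith [dist_triangle z y' y]
    have hBX : Metric.closedBall y' R ⊆ X := fun z hz =>
      hXb (Metric.mem_ball.2 ((hsub z hz).trans_lt hRδ'))
    have hup := hΔ.radial_mean_le_value hm (Nat.cast_nonneg d) hBX hr (half_lt_self hR) hy't (hb y')
    set v := y' - y
    have hsym : ∀ u w, inner ℝ (C u) w = inner ℝ u (C w) := hCpos.1
    -- Recentre the quadratic at `y'`: the constant `½ Cv · v ≥ 0` is dropped, and the cross term is
    -- linear in `z - y'`, so its radial mean vanishes.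
    have hpt : ∀ z ∈ Metric.closedBall y' R, φ z ≠ ⊤ →
        (inner ℝ x y' - f) + inner ℝ ((x + C v) + ((1 / 2 : ℝ) • C) (z - y')) (z - y')
          ≤ (φ z).toReal := by
      intro z hz hzt
      refine le_trans ?_ (hlow z (Metric.mem_ball.2 ((hsub z hz).trans_lt hRδ)) hzt)
      obtain ⟨u, hu⟩ : ∃ u, u = z - y' := ⟨_, rfl⟩
      have hz1 : z = y' + u := by simp [hu]
      have hz2 : z - y = u + v := by simp [hu, v]
      have h0 : 0 ≤ inner ℝ (C v) v := by simpa using hCpos.2 v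
      rw [← hu, hz2, hz1, map_add, smul_apply]
      simp only [inner_add_left, inner_add_right, inner_smul_left, conj_trivial]
      have h1 := hsym u v
      rw [real_inner_comm (C v) u] at h1
      linarith
    have hgint := hΔ.2.1.integrableOn_compact_subset hBX (isCompact_closedBall y' R)
    have hint : Integrable fun z =>
        inner ℝ ((x + C v) + ((1 / 2 : ℝ) • C) (z - y')) (z - y') * radialKernel y' r z :=
      integrable_mul_radialKernel hr (ContinuousOn.integrableOn_compact
        (isCompact_closedBall _ _) (by fun_prop))
    have hlower : ∫ z, ((inner ℝ x y' - f) * radialKernel y' r z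
        + inner ℝ ((x + C v) + ((1 / 2 : ℝ) • C) (z - y')) (z - y') * radialKernel y' r z)
        ≤ ∫ z, (φ z).toReal * radialKernel y' r z := by
      refine integral_mono_ae (((integrable_radialKernel y' hr).const_mul _).add hint)
        (integrable_mul_radialKernel hr (hgint.mono_set
          (Metric.closedBall_subset_closedBall (half_le_self hR.le)))) ?_
      -- Where `φ z = ⊤` its real part is 0 and the lower bound may fail; inside `X` such points
      -- form a null set.
      filter_upwards [hΔ.1] with z hz
      by_cases hzR : z ∈ Metric.closedBall y' R
      · rw [← add_mul]
        exact mul_le_mul_of_nonneg_right (hpt z hzR (hz (hBX hzR)).1) (radialKernel_nonneg y' hr z)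
      · rw [Metric.mem_closedBall, dist_eq_norm, not_le] at hzR
        have : r ≤ ‖z - y'‖ := ((half_le_self hR.le).trans_lt hzR).le
        simp [radialKernel_eq_zero hr this]
    rw [integral_add ((integrable_radialKernel y' hr).const_mul _) hint, integral_const_mul,
      integral_radialKernel y' hr, integral_inner_mul_radialKernel _ _ _ hr] at hlower
    have htr : LinearMap.trace ℝ (Euc d) (((1 / 2 : ℝ) • C : Euc d →L[ℝ] Euc d) :
        Euc d →ₗ[ℝ] Euc d) = 1 / 2 * T := by
      rw [ContinuousLinearMap.toLinearMap_smul, map_smul, smul_eq_mul]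
    rw [htr] at hlower
    have h9 : ((φ y').toReal - (inner ℝ x y' - f)) * kernelMass d ≤ η * kernelMass d :=
      mul_le_mul_of_nonneg_right (by linarith) hK
    linarith
  have h0 : r ^ 2 / 2 * bumpMass d * (T - d) ≤ 0 := by
    refine le_of_forall_pos_le_add fun η hη => ?_
    have h1 := key (η / (kernelMass d + 1)) (by positivity)
    have h2 : η / (kernelMass d + 1) * kernelMass d ≤ η := by
      rw [div_mul_eq_mul_div, div_le_iff₀ (by positivity)]
      nlinarith
    linarith
  by_contra! hT
  have : 0 < r ^ 2 / 2 * bumpMass d * (T - d) := by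
    have := sub_pos.2 hT
    positivity
  linarith

theorem one_le_det_hessian {X : Set (Euc d)} (hX : IsOpen X) {φ : Euc d → EReal}
    (hb : ∀ y, φ y ≠ ⊥) (hΔ : DistribLaplacianLE X φ d)
    (hm : AboveMeans X φ) (hp : IsProper (legendre φ)) (hc : IsConvexFn (legendre φ)) {x : Euc d}
    (hx : x ∈ interior {x | legendre φ x ≠ ⊤}) {A : Euc d →L[ℝ] Euc d}
    (hA : HasHessianAt (legendre φ) A x) (hy : gradMap (legendre φ) x ∈ X) : 1 ≤ A.det := by
  refine one_le_det_of_trace_inverse_le hA.1 ((hc.convexOn_finPart hp).inner_hessian_nonneg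
    (mem_interior_iff_mem_nhds.1 hx) hA.2.1 hA.2.2) fun ε hε C hCpos hC => ?_
  rw [finrank_euclideanSpace_fin]
  exact trace_inverse_hessian_le hX hb hΔ hm hp hc hx hA hy hε hCpos hC

end PointwiseDeterminant

/-! ### Injectivity of the gradient where the Hessian is nondegenerate. -/

section GradientInjectivity

variable {E : Type*} [NormedAddCommGroup E] [InnerProductSpace ℝ E]

/-- The Cauchy-Schwarz argument: test positivity at `v - t • A v`, with `t = b / (c + 1)` so that no
division by zero occurs. -/
theorem map_eq_zero_of_inner_nonpos {A : E →L[ℝ] E} (hA : (A : E →ₗ[ℝ] E).IsSymmetric)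
    (hpos : ∀ v, 0 ≤ inner ℝ (A v) v) {v : E} (hv : inner ℝ (A v) v ≤ 0) : A v = 0 := by
  obtain ⟨c, hc⟩ : ∃ c, c = inner ℝ (A (A v)) (A v) := ⟨_, rfl⟩
  have hc0 : 0 ≤ c := hc ▸ hpos _
  obtain ⟨b, hb⟩ : ∃ b, b = ‖A v‖ ^ 2 := ⟨_, rfl⟩
  have hb0 : 0 ≤ b := by rw [hb]; positivity
  have hs : inner ℝ (A (A v)) v = inner ℝ (A v) (A v) := hA (A v) v
  have h1 := hpos (v - (b / (c + 1)) • A v)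
  simp only [map_sub, map_smul, inner_sub_left, inner_sub_right, inner_smul_left,
    inner_smul_right, conj_trivial, hs, real_inner_self_eq_norm_sq, ← hb, ← hc] at h1
  have hq : b / (c + 1) * (c + 1) = b := div_mul_cancel₀ _ (by positivity)
  have hq0 : 0 ≤ b / (c + 1) := by positivity
  have hb1 : b = 0 := by nlinarith
  rw [hb1] at hb
  simpa using hb.symm

/-- Two points with the same gradient coincide as soon as the Hessian at one of them is
nondegenerate. -/
theorem ConvexOn.eq_of_gradient_eq [FiniteDimensional ℝ E] {D : Set E} {f : E → ℝ}
    (hf : ConvexOn ℝ D f) {x₁ x₂ : E} (hx₁ : D ∈ 𝓝 x₁) (hx₂ : x₂ ∈ D)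
    (hd₁ : DifferentiableAt ℝ f x₁) (hd₂ : DifferentiableAt ℝ f x₂)
    (hg : gradient f x₁ = gradient f x₂) {A : E →L[ℝ] E} (hsym : (A : E →ₗ[ℝ] E).IsSymmetric)
    (hA : (fun h => f (x₁ + h) - f x₁ - inner ℝ (gradient f x₁) h - (1 / 2) * inner ℝ (A h) h)
      =o[𝓝 0] (fun h => ‖h‖ ^ 2)) (hdet : A.det ≠ 0) : x₁ = x₂ := by
  have hx₁D := mem_of_mem_nhds hx₁
  have hpos := hf.inner_hessian_nonneg hx₁ hd₁ hA
  set v := x₂ - x₁ with hv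
  have h2 := hf.add_inner_gradient_le hx₂ hx₁D hd₂
  rw [← hg, ← neg_sub x₂ x₁, inner_neg_right, ← hv] at h2
  -- Equal gradients force `f` to be affine on the segment from `x₁` to `x₂`, so its second-order
  -- term along `v` vanishes.
  have hle : ∀ ε : ℝ, 0 < ε → inner ℝ (A v) v ≤ 0 + ε * (2 * ‖v‖ ^ 2) := by
    intro ε hε
    have htv : Tendsto (fun t : ℝ => t • v) (𝓝[>] 0) (𝓝 0) := by
      have hc : Continuous fun t : ℝ => t • v := by fun_prop
      have : Tendsto (fun t : ℝ => t • v) (𝓝 0) (𝓝 (0 : E)) := by simpa using hc.tendsto 0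
      exact this.mono_left nhdsWithin_le_nhds
    obtain ⟨t, h3, ht, ht1⟩ := ((htv.eventually (hA.def hε)).and
      (Ioo_mem_nhdsGT (show (0 : ℝ) < 1 by norm_num))).exists
    have h4 := (abs_le.1 h3).1
    have h5 := hf.2 hx₁D hx₂ (sub_nonneg.2 ht1.le) ht.le (by ring)
    have e1 : (1 - t) • x₁ + t • x₂ = x₁ + t • v := by rw [hv]; module
    rw [e1] at h5
    rw [norm_pow, norm_norm, norm_smul, Real.norm_of_nonneg ht.le, map_smul] at h4
    simp only [inner_smul_left, inner_smul_right, conj_trivial, smul_eq_mul] at h4 h5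
    have h6 : t ^ 2 * inner ℝ (A v) v ≤ t ^ 2 * (0 + ε * (2 * ‖v‖ ^ 2)) := by nlinarith
    exact le_of_mul_le_mul_left h6 (by positivity)
  have hAv : inner ℝ (A v) v ≤ 0 := by
    refine le_of_forall_pos_le_add fun η hη => ?_
    refine (hle (η / (2 * ‖v‖ ^ 2 + 1)) (by positivity)).trans ?_
    gcongr
    rw [div_mul_eq_mul_div, div_le_iff₀ (by positivity)]
    nlinarith [sq_nonneg ‖v‖]
  have h0 := map_eq_zero_of_inner_nonpos hsym hpos hAv
  have h1 : v = 0 := (A.toContinuousLinearEquivOfDetNeZero hdet).injective (by simpa using h0)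
  exact (sub_eq_zero.1 h1).symm

end GradientInjectivity

/-! ### Regular points, the area formula and push-forwards. -/

section Main

variable {d : ℕ}

/-- The points at which `ψ` has a nondegenerate Hessian that is also the derivative of `∇ψ`. -/
def IsRegularPoint (ψ : Euc d → EReal) (A : Euc d →L[ℝ] Euc d) (x : Euc d) : Prop :=
  x ∈ interior {x | ψ x ≠ ⊤} ∧ HasHessianAt ψ A x ∧ 1 ≤ A.det ∧
    HasFDerivWithinAt (gradMap ψ) A {z | ψ z ≠ ⊤ ∧ DifferentiableAt ℝ (finPart ψ) z} x

/-- The domain is convex, and the frontier of a convex set is null. -/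
theorem ae_mem_interior {ψ : Euc d → EReal} (hp : IsProper ψ) (hc : IsConvexFn ψ) :
    ∀ᵐ x, ψ x ≠ ⊤ → x ∈ interior {x | ψ x ≠ ⊤} := by
  have h := (hc.convexOn_finPart hp).1.addHaar_frontier (volume : Measure (Euc d))
  filter_upwards [measure_eq_zero_iff_ae_notMem.1 h] with x hx hxt
  by_contra hxi
  exact hx ⟨subset_closure hxt, hxi⟩

theorem IsLaplacianExpansion.ae_hessian {X : Set (Euc d)} {ψ : Euc d → EReal}
    (hψ : IsLaplacianExpansion X ψ) :
    ∀ᵐ x, ψ x ≠ ⊤ → x ∈ interior {x | ψ x ≠ ⊤} ∧ ∃ A, HasHessianAt ψ A x ∧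
      HasFDerivWithinAt (gradMap ψ) A {z | ψ z ≠ ⊤ ∧ DifferentiableAt ℝ (finPart ψ) z} x := by
  obtain ⟨hp, hl, hc, φ, ⟨hφb, y₀, hy₀⟩, -, -, -, -, rfl⟩ := hψ
  obtain ⟨J, hJ⟩ := exists_isResolvent (y₀ := y₀) hp hl hc
    fun x hx => inner_sub_le_legendre hp hx (hφb y₀) hy₀
  filter_upwards [ae_mem_interior hp hc,
    hJ.ae_exists_hessian (μ := volume) (hc.convexOn_finPart hp)] with x hx hA hxt
  obtain ⟨hd, A, hsym, hgrad, hexp⟩ := hA (hx hxt)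
  exact ⟨hx hxt, A, ⟨hsym, hd, hexp⟩, hgrad⟩

theorem IsLaplacianExpansion.ae_isRegularPoint {X : Set (Euc d)} (hX : IsOpen X)
    {ψ : Euc d → EReal} (hψ : IsLaplacianExpansion X ψ) :
    ∀ᵐ x, ψ x ≠ ⊤ → gradMap ψ x ∈ X → ∃ A, IsRegularPoint ψ A x := by
  filter_upwards [hψ.ae_hessian] with x hx hxt hxX
  obtain ⟨hxi, A, hA, hgrad⟩ := hx hxt
  refine ⟨A, hxi, hA, ?_, hgrad⟩
  obtain ⟨hp, -, hc, φ, ⟨hφb, -⟩, -, -, hΔ, hm, rfl⟩ := hψ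
  exact one_le_det_hessian hX hφb hΔ hm hp hc hxi hA hxX

theorem IsRegularPoint.hasFDerivWithinAt {ψ : Euc d → EReal} {S : Set (Euc d)}
    {A : Euc d → Euc d →L[ℝ] Euc d} (hS : ∀ x ∈ S, IsRegularPoint ψ (A x) x) :
    ∀ x ∈ S, HasFDerivWithinAt (gradMap ψ) (A x) S x := fun x hx =>
  (hS x hx).2.2.2.mono fun z hz => ⟨interior_subset (hS z hz).1, (hS z hz).2.1.2.1⟩

theorem IsRegularPoint.injOn {ψ : Euc d → EReal} (hp : IsProper ψ) (hc : IsConvexFn ψ)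
    {S : Set (Euc d)} {A : Euc d → Euc d →L[ℝ] Euc d}
    (hS : ∀ x ∈ S, IsRegularPoint ψ (A x) x) : Set.InjOn (gradMap ψ) S := fun x hx z hz hxz =>
  (hc.convexOn_finPart hp).eq_of_gradient_eq (mem_interior_iff_mem_nhds.1 (hS x hx).1)
    (interior_subset (hS z hz).1) (hS x hx).2.1.2.1 (hS z hz).2.1.2.1 hxz (hS x hx).2.1.1
    (hS x hx).2.1.2.2 (zero_lt_one.trans_le (hS x hx).2.2.1).ne'

theorem IsRegularPoint.one_le_ofReal {ψ : Euc d → EReal} {A : Euc d →L[ℝ] Euc d} {x : Euc d}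
    (h : IsRegularPoint ψ A x) : 1 ≤ ENNReal.ofReal |A.det| := by
  rw [ENNReal.one_le_ofReal]
  exact h.2.2.1.trans (le_abs_self _)

/-- On regular points the gradient does not decrease integrals. -/
theorem IsRegularPoint.setLIntegral_comp_le {ψ : Euc d → EReal} (hp : IsProper ψ)
    (hc : IsConvexFn ψ) {S : Set (Euc d)} (hSm : MeasurableSet S)
    {A : Euc d → Euc d →L[ℝ] Euc d} (hS : ∀ x ∈ S, IsRegularPoint ψ (A x) x)
    (g : Euc d → ENNReal) :
    ∫⁻ x in S, g (gradMap ψ x) ≤ ∫⁻ y in gradMap ψ '' S, g y := by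
  rw [lintegral_image_eq_lintegral_abs_det_fderiv_mul volume hSm
    (IsRegularPoint.hasFDerivWithinAt hS) (IsRegularPoint.injOn hp hc hS)]
  refine setLIntegral_mono_ae' hSm (Eventually.of_forall fun x hx => ?_)
  exact le_mul_of_one_le_left' (hS x hx).one_le_ofReal

/-- The area formula needs a measurable set. Removing a measurable null superset of the bad points
provides one, without any measurability of the chosen Hessians. -/
theorem IsLaplacianExpansion.exists_regular_set {X : Set (Euc d)} (hX : IsOpen X)
    {ψ : Euc d → EReal} (hψ : IsLaplacianExpansion X ψ) :
    ∃ (S : Set (Euc d)) (A : Euc d → Euc d →L[ℝ] Euc d), MeasurableSet S ∧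
      (∀ x ∈ S, IsRegularPoint ψ (A x) x) ∧ ∀ᵐ x, ψ x ≠ ⊤ → gradMap ψ x ∈ X → x ∈ S := by
  classical
  obtain ⟨N, hN, hNm, hN0⟩ := exists_measurable_superset_of_null
    (ae_iff.1 (hψ.ae_isRegularPoint hX))
  have hS : ∀ x, ψ x ≠ ⊤ ∧ gradMap ψ x ∈ X ∧ x ∉ N → ∃ A, IsRegularPoint ψ A x := by
    intro x hx
    by_contra h
    exact hx.2.2 (hN fun h' => h (h' hx.1 hx.2.1))
  choose! A hA using hS
  refine ⟨{x | ψ x ≠ ⊤ ∧ gradMap ψ x ∈ X ∧ x ∉ N}, A, ?_, hA, ?_⟩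
  · have h1 : MeasurableSet {x | ψ x ≠ ⊤} :=
      (hψ.2.1.measurable (measurableSet_singleton ⊤)).compl
    exact h1.inter ((measurable_gradMap ψ hX.measurableSet).inter hNm.compl)
  · filter_upwards [measure_eq_zero_iff_ae_notMem.1 hN0] with x hx h1 h2 using ⟨h1, h2, hx⟩

theorem IsLaplacianExpansion.volume_le_volume_image {X : Set (Euc d)} (hX : IsOpen X)
    {ψ : Euc d → EReal} (hψ : IsLaplacianExpansion X ψ) {E : Set (Euc d)} (hE : MeasurableSet E)
    (hEX : ∀ᵐ x, x ∈ E → ψ x ≠ ⊤ ∧ gradMap ψ x ∈ X) :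
    volume E ≤ volume (gradMap ψ '' E) := by
  obtain ⟨S, A, hSm, hS, hae⟩ := hψ.exists_regular_set hX
  have h1 : volume E ≤ volume (E ∩ S) := by
    refine measure_mono_ae ?_
    filter_upwards [hae, hEX] with x hx hxE hxm
    exact ⟨hxm, hx (hxE hxm).1 (hxE hxm).2⟩
  have h2 := IsRegularPoint.setLIntegral_comp_le hψ.1 hψ.2.2.1 (hE.inter hSm)
    (fun x hx => hS x hx.2) 1
  simp only [Pi.one_apply, lintegral_one, Measure.restrict_apply_univ] at h2
  exact h1.trans (h2.trans (measure_mono (Set.image_mono Set.inter_subset_left)))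

theorem IsLaplacianExpansion.map_gradMap_absolutelyContinuous {X : Set (Euc d)} (hX : IsOpen X)
    {ψ : Euc d → EReal} (hψ : IsLaplacianExpansion X ψ) {ν : Measure (Euc d)} (hν : ν ≪ volume)
    (hνX : ∀ᵐ x ∂ν, ψ x ≠ ⊤ ∧ gradMap ψ x ∈ X) : ν.map (gradMap ψ) ≪ volume := by
  obtain ⟨S, A, hSm, hS, hae⟩ := hψ.exists_regular_set hX
  refine Measure.AbsolutelyContinuous.mk fun N hN hN0 => ?_
  rw [Measure.map_apply (measurable_gradMap ψ) hN]
  have h1 := IsRegularPoint.setLIntegral_comp_le hψ.1 hψ.2.2.1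
    ((measurable_gradMap ψ hN).inter hSm) (fun x hx => hS x hx.2) 1
  simp only [Pi.one_apply, lintegral_one, Measure.restrict_apply_univ] at h1
  have h2 : volume (gradMap ψ ⁻¹' N ∩ S) = 0 := by
    refine le_antisymm (h1.trans ((measure_mono ?_).trans hN0.le)) zero_le
    rintro _ ⟨x, hx, rfl⟩
    exact hx.1
  refine le_antisymm (le_trans (measure_mono_ae ?_) (hν h2).le) zero_le
  filter_upwards [hν.ae_le hae, hνX] with x hx hxX hxN using ⟨hxN, hx hxX.1 hxX.2⟩

theorem IsLaplacianExpansion.rnDeriv_map_gradMap_le {X : Set (Euc d)} (hX : IsOpen X)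
    {ψ : Euc d → EReal} (hψ : IsLaplacianExpansion X ψ) {ν : Measure (Euc d)} [SigmaFinite ν]
    (hν : ν ≪ volume) (hνX : ∀ᵐ x ∂ν, ψ x ≠ ⊤ ∧ gradMap ψ x ∈ X) :
    ∀ᵐ x, ψ x ≠ ⊤ → gradMap ψ x ∈ X →
      (ν.map (gradMap ψ)).rnDeriv volume (gradMap ψ x) ≤ ν.rnDeriv volume x := by
  obtain ⟨S, A, hSm, hS, hae⟩ := hψ.exists_regular_set hX
  have hinj := IsRegularPoint.injOn hψ.1 hψ.2.2.1 hS
  have key : ∀ᵐ x ∂volume.restrict S,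
      (ν.map (gradMap ψ)).rnDeriv volume (gradMap ψ x) ≤ ν.rnDeriv volume x := by
    refine ae_le_of_forall_setLIntegral_le_of_sigmaFinite
      ((Measure.measurable_rnDeriv _ _).comp (measurable_gradMap ψ)) fun F hF _ => ?_
    rw [Measure.restrict_restrict hF]
    have hFS : MeasurableSet (F ∩ S) := hF.inter hSm
    have hFreg : ∀ x ∈ F ∩ S, IsRegularPoint ψ (A x) x := fun x hx => hS x hx.2
    refine (IsRegularPoint.setLIntegral_comp_le hψ.1 hψ.2.2.1 hFS hFreg _).trans ?_
    -- Only this inequality is needed for the push-forward, so its σ-finiteness need not be checked.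
    -- What remains is that the preimage of the image of `F ∩ S` is contained in `F ∩ S` up to a
    -- `ν`-null set, by injectivity on `S`.
    refine (Measure.setLIntegral_rnDeriv_le _).trans ?_
    rw [Measure.setLIntegral_rnDeriv hν, Measure.map_apply (measurable_gradMap ψ)
      (measurable_image_of_fderivWithin hFS (IsRegularPoint.hasFDerivWithinAt hFreg)
        (hinj.mono Set.inter_subset_right))]
    refine measure_mono_ae ?_
    filter_upwards [hν.ae_le hae, hνX] with x hx hxX hxF
    obtain ⟨z, hz, hzx⟩ := hxF
    have hzx : z = x := hinj hz.2 (hx hxX.1 hxX.2) hzx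
    exact hzx ▸ hz
  filter_upwards [(ae_restrict_iff' hSm).1 key, hae] with x hx hxS h1 h2 using hx (hxS h1 h2)

end Main

theorem mainTheorem12 {d : ℕ} (X : Set (Euc d)) (hX : IsOpen X) (ψ : Euc d → EReal)
    (hψ : IsLaplacianExpansion X ψ) :
    -- `D²ψ` exists almost everywhere in the domain of `ψ`
    (∀ᵐ x : Euc d, ψ x ≠ ⊤ → ∃ A : Euc d →L[ℝ] Euc d, HasHessianAt ψ A x) ∧
    -- and `det D²ψ ≥ 1` almost everywhere
    (∀ᵐ x : Euc d, ψ x ≠ ⊤ → gradMap ψ x ∈ X →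
      ∃ A : Euc d →L[ℝ] Euc d, HasHessianAt ψ A x ∧ 1 ≤ A.det) ∧
    -- `∇ψ` increases volume
    (∀ E : Set (Euc d), MeasurableSet E →
      (∀ x ∈ E, ψ x ≠ ⊤ ∧ DifferentiableAt ℝ (finPart ψ) x ∧ gradMap ψ x ∈ X) →
      volume E ≤ volume (gradMap ψ '' E)) ∧
    -- push-forwards of absolutely continuous measures
    (∀ ν : Measure (Euc d), SigmaFinite ν → ν ≪ volume →
      (∀ᵐ x ∂ν, ψ x ≠ ⊤ ∧ gradMap ψ x ∈ X) →
      ν.map (gradMap ψ) ≪ volume ∧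
      ∀ᵐ x : Euc d, ψ x ≠ ⊤ → gradMap ψ x ∈ X →
        (ν.map (gradMap ψ)).rnDeriv volume (gradMap ψ x) ≤ ν.rnDeriv volume x) := by
  refine ⟨?_, ?_, fun E hE hEX => ?_, fun ν _ hν hνX => ?_⟩
  · filter_upwards [hψ.ae_hessian] with x hx hxt
    obtain ⟨-, A, hA, -⟩ := hx hxt
    exact ⟨A, hA⟩
  · filter_upwards [hψ.ae_isRegularPoint hX] with x hx hxt hxX
    obtain ⟨A, hA⟩ := hx hxt hxX
    exact ⟨A, hA.2.1, hA.2.2.1⟩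
  · exact hψ.volume_le_volume_image hX hE
      (Eventually.of_forall fun x hx => ⟨(hEX x hx).1, (hEX x hx).2.2⟩)
  · exact ⟨hψ.map_gradMap_absolutelyContinuous hX hν hνX,
      hψ.rnDeriv_map_gradMap_le hX hν hνX⟩
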